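/- Let $G$ be a countable discrete group acting continuously on a compact metrizable space $X$. **Notation.** $C(X)_+$ is the set of continuous functions $f:X\to[0,\infty)$, and $\operatorname{supp}(f)=\{x\in X: f(x)\ne 0\}$ is the open support. For open sets $O_1,\dots,O_n$ and $V_1,\dots,V_m$ of $X$ write $$\bigsqcup_{i=1}^n O_i\times\{i\}\prec\bigsqcup_{r=1}^m V_r\times\{r\}$$ if for all closed sets $F_i\subset O_i$ ($1\le i\le n$) there are, for each $i$, finitely many open sets $U^{(i)}_1,\dots,U^{(i)}_{J_i}$ covering $F_i$, elements $s^{(i)}_1,\dots,s^{(i)}_{J_i}\in G$ and labels $c^{(i)}_1,\dots,c^{(i)}_{J_i}\in\{1,\dots,m\}$ such that the sets $s^{(i)}_jU^{(i)}_j\times\{c^{(i)}_j\}$, over all pairs $(i,j)$, are pairwise disjoint and contained in $\bigsqcup_{r=1}^m V_r\times\{r\}$. On $K(X,G)=\bigcup_{n\ge1}C(X)_+^{\,n}$ put $(f_1,\dots,f_n)\preccurlyeq(g_1,\dots,g_m)$ if $\bigsqcup_i\operatorname{supp}(f_i)\times\{i\}\prec\bigsqcup_r\operatorname{supp}(g_r)\times\{r\}$,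 and $a\approx b$ if $a\preccurlyeq b$ and $b\preccurlyeq a$. The generalized type semigroup is $W(X,G)=K(X,G)/{\approx}$, with addition $[a]+[b]=[(a,b)]$ (concatenation of tuples) and order $[a]\le[b]\iff a\preccurlyeq b$. Let $\mathcal A_0$ be the algebra of sets generated by the open subsets of $X$. A premeasure on $\mathcal A_0$ is a function $\mu:\mathcal A_0\to[0,\infty]$ with $\mu(\emptyset)=0$ and $\mu\big(\bigsqcup_{n}A_n\big)=\sum_{n}\mu(A_n)$ for every disjoint sequence $(A_n)$ in $\mathcal A_0$ with union in $\mathcal A_0$. $\operatorname{Pr}_G(X)$ is the set of $G$-invariant premeasures $\mu$ on $\mathcal A_0$ that are regular: $\mu(B)=\sup\{\mu(F):F\subset B,\ F\text{ compact}\}=\inf\{\mu(O):B\subset O,\ O\text{ open}\}$ for all $B\in\mathcal A_0$. **Theorem 3.9.** Fix integers $k,l\ge 1$. The following are equivalent. (i) For all $a=(f_1,\dots,f_k)\in C(X)_+^{\,k}$ and $b=(g_1,\dots,g_l)\in C(X)_+^{\,l}$: if there is an integer $n\ge1$ with $(n+1)[a]\le n[b]$ in $W(X,G)$, then $[a]\le[b]$.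 (ii) For all $a=(f_1,\dots,f_k)\in C(X)_+^{\,k}$ and $b=(g_1,\dots,g_l)\in C(X)_+^{\,l}$, with $A_i=\operatorname{supp}(f_i)$ and $B_j=\operatorname{supp}(g_j)$: if $\bigcup_{i=1}^kA_i\subset G\cdot\big(\bigcup_{j=1}^lB_j\big)$ and $\sum_{i=1}^k\mu(A_i)<\sum_{j=1}^l\mu(B_j)$ for every $\mu\in\operatorname{Pr}_G(X)$ with $\sum_{j=1}^l\mu(B_j)=1$, then $a\preccurlyeq b$. -/

import Mathlib

open scoped NNReal ENNReal Pointwise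

namespace TypeSemigroup

/-! ### The relation `⊔ Oᵢ × {i} ≺ ⊔ Vₗ × {l}` -/

section Relation

variable (G : Type*) {X : Type*} [Group G] [TopologicalSpace X] [MulAction G X]

/-- `⊔ᵢ Oᵢ × {i} ≺ ⊔ₗ Vₗ × {l}`: for all closed sets `Fᵢ ⊆ Oᵢ` there are finite families of open
sets `U i j` covering `Fᵢ`, group elements `s i j` and labels `c i j` such that the sets
`(s i j • U i j) × {c i j}` are pairwise disjoint (over all pairs `(i, j)`) and contained in
`⊔ₗ Vₗ × {l}`. Containment and disjointness are written out label by label. -/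
def SubEquiv {ι κ : Type*} (O : ι → Set X) (V : κ → Set X) : Prop :=
  ∀ F : ι → Set X, (∀ i, IsClosed (F i) ∧ F i ⊆ O i) →
    ∃ (J : ι → ℕ) (U : ∀ i, Fin (J i) → Set X) (s : ∀ i, Fin (J i) → G)
      (c : ∀ i, Fin (J i) → κ),
      (∀ i j, IsOpen (U i j)) ∧
      (∀ i, F i ⊆ ⋃ j, U i j) ∧
      (∀ i j, s i j • U i j ⊆ V (c i j)) ∧
      Pairwise fun p q : (Σ i, Fin (J i)) =>
        c p.1 p.2 = c q.1 q.2 → Disjoint (s p.1 p.2 • U p.1 p.2) (s q.1 q.2 • U q.1 q.2)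

variable {G}

/-- Finite index types other than `Fin` may be used to verify `SubEquiv`. -/
theorem SubEquiv.of_finite {ι κ : Type*} {O : ι → Set X} {V : κ → Set X}
    (h : ∀ F : ι → Set X, (∀ i, IsClosed (F i) ∧ F i ⊆ O i) →
      ∃ (T : ι → Type) (_ : ∀ i, Finite (T i)) (U : ∀ i, T i → Set X) (s : ∀ i, T i → G)
        (c : ∀ i, T i → κ),
        (∀ i j, IsOpen (U i j)) ∧
        (∀ i, F i ⊆ ⋃ j, U i j) ∧
        (∀ i j, s i j • U i j ⊆ V (c i j)) ∧
        Pairwise fun p q : (Σ i, T i) =>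
          c p.1 p.2 = c q.1 q.2 → Disjoint (s p.1 p.2 • U p.1 p.2) (s q.1 q.2 • U q.1 q.2)) :
    SubEquiv G O V := by
  intro F hF
  obtain ⟨T, hT, U, s, c, h1, h2, h3, h4⟩ := h F hF
  have e : ∀ i, Fin (Nat.card (T i)) ≃ T i := fun i => (Finite.equivFin (T i)).symm
  refine ⟨fun i => Nat.card (T i), fun i j => U i (e i j), fun i j => s i (e i j),
    fun i j => c i (e i j), fun i j => h1 _ _, fun i x hx => ?_, fun i j => h3 _ _, ?_⟩
  · obtain ⟨j, hj⟩ := Set.mem_iUnion.1 (h2 i hx)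
    exact Set.mem_iUnion.2 ⟨(e i).symm j, by simpa using hj⟩
  · rintro ⟨i, j⟩ ⟨i', j'⟩ hne hc
    refine h4 (i := ⟨i, e i j⟩) (j := ⟨i', e i' j'⟩) (fun heq => hne ?_) hc
    obtain rfl : i = i' := congrArg Sigma.fst heq
    have := (e i).injective (eq_of_heq (Sigma.mk.inj heq).2)
    rw [this]

theorem SubEquiv.of_map {ι κ : Type*} {O : ι → Set X} {V : κ → Set X}
    (hO : ∀ i, IsOpen (O i)) (c : {i // (O i).Nonempty} → κ) (hc : Function.Injective c)
    (h : ∀ i, O i.1 ⊆ V (c i)) : SubEquiv G O V := by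
  refine SubEquiv.of_finite fun F hF =>
    ⟨fun i => PLift (O i).Nonempty, fun i => inferInstance, fun i _ => O i, fun _ _ => 1,
      fun i p => c ⟨i, p.down⟩, fun i _ => hO i, fun i x hx => ?_, fun i p => ?_, ?_⟩
  · exact Set.mem_iUnion.2 ⟨⟨⟨x, (hF i).2 hx⟩⟩, (hF i).2 hx⟩
  · rw [one_smul]; exact h ⟨i, p.down⟩
  · rintro ⟨i, p⟩ ⟨i', p'⟩ hne hcc
    obtain rfl : i = i' := congrArg Subtype.val (hc hcc)
    obtain rfl : p = p' := Subsingleton.elim _ _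
    exact (hne rfl).elim

theorem SubEquiv.trans [NormalSpace X] [ContinuousConstSMul G X] {ι κ τ : Type*} [Finite ι]
    {A : ι → Set X} {B : κ → Set X} {C : τ → Set X}
    (hAB : SubEquiv G A B) (hBC : SubEquiv G B C) : SubEquiv G A C := by
  refine SubEquiv.of_finite fun F hF => ?_
  obtain ⟨J, U, s, c, h1, h2, h3, h4⟩ := hAB F hF
  have hs : ∀ i, ∃ v : Fin (J i) → Set X, F i ⊆ Set.iUnion v ∧ (∀ j, IsOpen (v j)) ∧
      ∀ j, closure (v j) ⊆ U i j := fun i =>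
    exists_subset_iUnion_closure_subset (hF i).1 (h1 i) (fun _ _ => Set.toFinite _) (h2 i)
  choose v hv1 hv2 hv3 using hs
  obtain ⟨P, W, t, d, k1, k2, k3, k4⟩ := hBC
    (fun l => ⋃ p : {p : Σ i, Fin (J i) // c p.1 p.2 = l},
      s p.1.1 p.1.2 • closure (v p.1.1 p.1.2)) (fun l => by
      constructor
      · exact isClosed_iUnion_of_finite fun p => isClosed_closure.smul _
      · refine Set.iUnion_subset fun p => ?_
        obtain ⟨⟨i, j⟩, rfl⟩ := p
        exact (Set.smul_set_mono (hv3 i j)).trans (h3 i j))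
  refine ⟨fun i => Σ j : Fin (J i), Fin (P (c i j)), fun i => inferInstance,
    fun i q => v i q.1 ∩ (s i q.1)⁻¹ • W (c i q.1) q.2,
    fun i q => t (c i q.1) q.2 * s i q.1, fun i q => d (c i q.1) q.2,
    fun i q => (hv2 _ _).inter ((k1 _ _).smul _), fun i x hx => ?_, fun i q => ?_, ?_⟩
  · obtain ⟨j, hj⟩ := Set.mem_iUnion.1 (hv1 i hx)
    have : s i j • x ∈ ⋃ p, W (c i j) p := k2 _ (Set.mem_iUnion.2
      ⟨⟨⟨i, j⟩, rfl⟩, Set.smul_mem_smul_set (subset_closure hj)⟩)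
    obtain ⟨p, hp⟩ := Set.mem_iUnion.1 this
    exact Set.mem_iUnion.2 ⟨⟨j, p⟩, hj, Set.mem_inv_smul_set_iff.2 hp⟩
  · refine subset_trans ?_ (k3 (c i q.1) q.2)
    rw [mul_smul]
    refine Set.smul_set_mono ?_
    refine (Set.smul_set_mono Set.inter_subset_right).trans ?_
    rw [smul_inv_smul]
  · rintro ⟨i, j, p⟩ ⟨i', j', p'⟩ hne hd
    have sub1 : ∀ i j p, (t (c i j) p * s i j) • (v i j ∩ (s i j)⁻¹ • W (c i j) p) ⊆
        t (c i j) p • W (c i j) p := fun i j p => by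
      rw [mul_smul]
      refine Set.smul_set_mono ((Set.smul_set_mono Set.inter_subset_right).trans ?_)
      rw [smul_inv_smul]
    have sub2 : ∀ i j p, (t (c i j) p * s i j) • (v i j ∩ (s i j)⁻¹ • W (c i j) p) ⊆
        t (c i j) p • s i j • U i j := fun i j p => by
      rw [mul_smul]
      exact Set.smul_set_mono (Set.smul_set_mono
        (Set.inter_subset_left.trans (subset_closure.trans (hv3 i j))))
    by_cases hl : (⟨c i j, p⟩ : Σ l, Fin (P l)) = ⟨c i' j', p'⟩
    · have ht : t (c i j) p = t (c i' j') p' :=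
        congrArg (fun q : Σ l, Fin (P l) => t q.1 q.2) hl
      have hc : c i j = c i' j' := congrArg Sigma.fst hl
      have hij : (⟨i, j⟩ : Σ i, Fin (J i)) ≠ ⟨i', j'⟩ := by
        intro heq
        obtain rfl : i = i' := congrArg Sigma.fst heq
        obtain rfl : j = j' := eq_of_heq (Sigma.mk.inj heq).2
        obtain rfl : p = p' := eq_of_heq (Sigma.mk.inj hl).2
        exact hne rfl
      refine Set.disjoint_of_subset (sub2 i j p) (sub2 i' j' p') ?_
      rw [← ht]
      exact (h4 hij hc).image (MulAction.injective _).injOn (Set.subset_univ _) (Set.subset_univ _)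
    · exact Set.disjoint_of_subset (sub1 i j p) (sub1 i' j' p') (k4 hl hd)

theorem SubEquiv.sum {ι κ ι' κ' : Type*} {O : ι → Set X} {V : κ → Set X}
    {O' : ι' → Set X} {V' : κ' → Set X} (h : SubEquiv G O V) (h' : SubEquiv G O' V') :
    SubEquiv G (Sum.elim O O') (Sum.elim V V') := by
  intro F hF
  obtain ⟨J, U, s, c, h1, h2, h3, h4⟩ := h (fun i => F (.inl i)) fun i => hF (.inl i)
  obtain ⟨J', U', s', c', k1, k2, k3, k4⟩ := h' (fun i => F (.inr i)) fun i => hF (.inr i)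
  refine ⟨Sum.elim J J', Sum.rec U U', Sum.rec s s', Sum.rec (fun i j => .inl (c i j))
    (fun i j => .inr (c' i j)), Sum.rec h1 k1, Sum.rec h2 k2, Sum.rec h3 k3, ?_⟩
  rintro ⟨i | i, j⟩ ⟨i' | i', j'⟩ hne hc
  · refine h4 (i := ⟨i, j⟩) (j := ⟨i', j'⟩) (fun heq => hne ?_) (Sum.inl.inj hc)
    cases heq; rfl
  · cases hc
  · cases hc
  · refine k4 (i := ⟨i, j⟩) (j := ⟨i', j'⟩) (fun heq => hne ?_) (Sum.inr.inj hc)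
    cases heq; rfl

end Relation

/-! ### The generalized type semigroup `W(X, G)` -/

section Semigroup

/-- `K(X, G) = ⋃_{n ≥ 1} (C(X)₊)ⁿ`: nonempty finite tuples of nonnegative continuous functions. -/
structure K (X : Type*) [TopologicalSpace X] where
  len : ℕ
  len_pos : 0 < len
  fn : Fin len → C(X, ℝ≥0)

variable {X : Type*} [TopologicalSpace X]

/-- The open support `{x | f x ≠ 0}`. -/
def supp (f : C(X, ℝ≥0)) : Set X := {x | f x ≠ 0}

theorem isOpen_supp (f : C(X, ℝ≥0)) : IsOpen (supp f) :=
  isOpen_ne_fun f.continuous continuous_const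

/-- The tuple of open supports of an element of `K(X, G)`. -/
def K.supp (a : K X) : Fin a.len → Set X := fun i => TypeSemigroup.supp (a.fn i)

/-- Concatenation of tuples. -/
def K.concat (a b : K X) : K X :=
  ⟨a.len + b.len, Nat.add_pos_left a.len_pos _, Fin.append a.fn b.fn⟩

theorem K.concat_fn_left (a b : K X) (i : Fin a.len) :
    (a.concat b).fn (Fin.castAdd b.len i : Fin (a.len + b.len)) = a.fn i :=
  Fin.append_left _ _ _

theorem K.concat_fn_right (a b : K X) (i : Fin b.len) :
    (a.concat b).fn (Fin.natAdd a.len i : Fin (a.len + b.len)) = b.fn i :=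
  Fin.append_right _ _ _

variable (G : Type*) [Group G] [MulAction G X]

/-- `a ≼ b` on `K(X, G)`. -/
def K.Le (a b : K X) : Prop := SubEquiv G a.supp b.supp

variable {G}

theorem K.le_of_map {a b : K X} (c : {i // (a.supp i).Nonempty} → Fin b.len)
    (hc : Function.Injective c) (h : ∀ i, a.supp i.1 ⊆ b.supp (c i)) : K.Le G a b :=
  SubEquiv.of_map (fun _ => isOpen_supp _) c hc h

theorem K.le_of_inj {a b : K X} (c : Fin a.len → Fin b.len)
    (hc : Function.Injective c) (h : ∀ i, a.fn i = b.fn (c i)) : K.Le G a b :=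
  K.le_of_map (fun i => c i.1) (hc.comp Subtype.val_injective)
    fun i => by simp only [K.supp, h]; exact subset_rfl

theorem K.le_refl (a : K X) : K.Le G a a := K.le_of_inj id Function.injective_id fun _ => rfl

theorem K.le_trans [CompactSpace X] [T2Space X] [ContinuousConstSMul G X] {a b c : K X}
    (h : K.Le G a b) (h' : K.Le G b c) : K.Le G a c := SubEquiv.trans h h'

theorem K.concat_le [CompactSpace X] [T2Space X] [ContinuousConstSMul G X] {a a' b b' : K X}
    (h : K.Le G a a') (h' : K.Le G b b') : K.Le G (a.concat b) (a'.concat b') := by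
  have e : ∀ a b : K X, ∀ i, (a.concat b).supp (finSumFinEquiv i : Fin (a.len + b.len)) =
      Sum.elim a.supp b.supp i := by
    rintro a b (i | i)
    · exact congrArg TypeSemigroup.supp (K.concat_fn_left a b i)
    · exact congrArg TypeSemigroup.supp (K.concat_fn_right a b i)
  have h1 : SubEquiv G (K.concat a b).supp (Sum.elim a.supp b.supp) := by
    refine SubEquiv.of_map (fun _ => isOpen_supp _)
      (fun i => finSumFinEquiv.symm (i.1 : Fin (a.len + b.len)))
      (finSumFinEquiv.symm.injective.comp Subtype.val_injective) fun i => ?_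
    have := e a b (finSumFinEquiv.symm (i.1 : Fin (a.len + b.len)))
    exact ((congrArg (a.concat b).supp
      (finSumFinEquiv.apply_symm_apply (i.1 : Fin (a.len + b.len)))).symm.trans this).subset
  have h2 : SubEquiv G (Sum.elim a'.supp b'.supp) (K.concat a' b').supp := by
    refine SubEquiv.of_map ?_ (fun i => (finSumFinEquiv i.1 : Fin (a'.len + b'.len)))
      (finSumFinEquiv.injective.comp Subtype.val_injective) fun i => (e a' b' i.1).symm.subset
    rintro (i | i)
    · exact isOpen_supp _
    · exact isOpen_supp _
  exact (h1.trans (h.sum h')).trans h2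

theorem K.concat_comm_le (a b : K X) : K.Le G (a.concat b) (b.concat a) := by
  refine K.le_of_inj (b := K.concat b a)
    (fun i : Fin (a.len + b.len) =>
      (finSumFinEquiv (finSumFinEquiv.symm i).swap : Fin (b.len + a.len)))
    (finSumFinEquiv.injective.comp
      ((Equiv.sumComm _ _).injective.comp finSumFinEquiv.symm.injective)) ?_
  intro (i : Fin (a.len + b.len))
  obtain ⟨i, rfl⟩ := finSumFinEquiv.surjective i
  rw [Equiv.symm_apply_apply]
  rcases i with i | i
  · exact (K.concat_fn_left a b i).trans (K.concat_fn_right b a i).symm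
  · exact (K.concat_fn_right a b i).trans (K.concat_fn_left b a i).symm

theorem K.concat_assoc_le (a b c : K X) :
    K.Le G ((a.concat b).concat c) (a.concat (b.concat c)) ∧
      K.Le G (a.concat (b.concat c)) ((a.concat b).concat c) := by
  have e := Fin.append_assoc a.fn b.fn c.fn
  have h := Nat.add_assoc a.len b.len c.len
  constructor
  · exact K.le_of_inj (a := (a.concat b).concat c) (b := a.concat (b.concat c))
      (fun i => Fin.cast h i) (Fin.cast_injective h) fun i => congrFun e i
  · exact K.le_of_inj (a := a.concat (b.concat c)) (b := (a.concat b).concat c)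
      (fun i => Fin.cast h.symm i) (Fin.cast_injective h.symm)
      fun i => (congrFun e (Fin.cast h.symm i)).symm

/-- The one-entry tuple `(0)`. -/
def K.zero : K X := ⟨1, one_pos, fun _ => 0⟩

theorem K.zero_concat_le (a : K X) :
    K.Le G (K.zero.concat a) a ∧ K.Le G a (K.zero.concat a) := by
  constructor
  · have key : ∀ i : Fin ((K.zero : K X).len + a.len), ((K.zero.concat a).supp i).Nonempty →
        ∃ j : Fin a.len, i = Fin.natAdd (K.zero : K X).len j := by
      intro i hi
      obtain ⟨i, rfl⟩ := finSumFinEquiv.surjective i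
      rcases i with i | i
      · obtain ⟨x, hx⟩ := hi
        have : (K.zero.concat a).fn (finSumFinEquiv (Sum.inl i)) x ≠ 0 := hx
        exact (this (congrArg (fun f : C(X, ℝ≥0) => f x) (K.concat_fn_left K.zero a i))).elim
      · exact ⟨i, rfl⟩
    choose c hc using key
    refine K.le_of_map (fun i => c i.1 i.2) ?_ ?_
    · rintro ⟨i, hi⟩ ⟨j, hj⟩ hij
      exact Subtype.ext ((hc i hi).trans ((congrArg _ hij).trans (hc j hj).symm))
    · rintro ⟨i, hi⟩
      have : (K.zero.concat a).supp i = a.supp (c i hi) :=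
        (congrArg (K.zero.concat a).supp (hc i hi)).trans
          (congrArg TypeSemigroup.supp (K.concat_fn_right K.zero a (c i hi)))
      exact this.subset
  · exact K.le_of_inj (b := K.zero.concat a) (fun i => Fin.natAdd (K.zero : K X).len i)
      (Fin.natAdd_injective _ _) fun i => (K.concat_fn_right K.zero a i).symm

variable (G) (X)

/-- `a ≈ b` iff `a ≼ b` and `b ≼ a`. -/
def typeSetoid [CompactSpace X] [T2Space X] [ContinuousConstSMul G X] : Setoid (K X) where
  r a b := K.Le G a b ∧ K.Le G b a
  iseqv := ⟨fun a => ⟨K.le_refl a, K.le_refl a⟩, fun h => ⟨h.2, h.1⟩,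
    fun h h' => ⟨K.le_trans h.1 h'.1, K.le_trans h'.2 h.2⟩⟩

/-- The generalized type semigroup `W(X, G) = K(X, G)/≈`. -/
def W [CompactSpace X] [T2Space X] [ContinuousConstSMul G X] : Type _ :=
  Quotient (typeSetoid X G)

variable {X} [CompactSpace X] [T2Space X] [ContinuousConstSMul G X]

/-- The class `[a]` in `W(X, G)`. -/
def W.mk (a : K X) : W X G := Quotient.mk (typeSetoid X G) a

variable {G}

/-- The order on `W(X, G)`: `[a] ≤ [b]` iff `a ≼ b`. -/
instance : PartialOrder (W X G) where
  le := Quotient.lift₂ (K.Le G) fun _ _ _ _ h h' => propext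
    ⟨fun k => K.le_trans h.2 (K.le_trans k h'.1), fun k => K.le_trans h.1 (K.le_trans k h'.2)⟩
  le_refl := by rintro ⟨a⟩; exact K.le_refl a
  le_trans := by rintro ⟨a⟩ ⟨b⟩ ⟨c⟩ h h'; exact K.le_trans (b := b) h h'
  le_antisymm := by rintro ⟨a⟩ ⟨b⟩ h h'; exact Quotient.sound ⟨h, h'⟩

theorem W.mk_le_mk {a b : K X} : W.mk G a ≤ W.mk G b ↔ K.Le G a b := Iff.rfl

/-- Addition on `W(X, G)`: `[a] + [b] = [(a, b)]`. -/
instance : Add (W X G) where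
  add := Quotient.map₂ K.concat fun _ _ h _ _ h' =>
    ⟨K.concat_le h.1 h'.1, K.concat_le h.2 h'.2⟩

/-- The neutral element of `W(X, G)` is the class of the tuple `(0)`. -/
instance : Zero (W X G) where
  zero := W.mk G K.zero

/-- `W(X, G)` is a commutative monoid; `n • x` is the usual multiple `x + ⋯ + x`. -/
instance : AddCommMonoid (W X G) where
  add_assoc := by
    rintro ⟨a⟩ ⟨b⟩ ⟨c⟩
    exact Quotient.sound (K.concat_assoc_le a b c)
  add_comm := by
    rintro ⟨a⟩ ⟨b⟩
    exact Quotient.sound ⟨K.concat_comm_le a b, K.concat_comm_le b a⟩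
  zero_add := by
    rintro ⟨a⟩
    exact Quotient.sound (K.zero_concat_le a)
  add_zero := by
    rintro ⟨a⟩
    exact Eq.trans (Quotient.sound ⟨K.concat_comm_le a _, K.concat_comm_le _ a⟩)
      (Quotient.sound (K.zero_concat_le a))
  nsmul := nsmulRec

theorem W.mk_add_mk (a b : K X) : W.mk G a + W.mk G b = W.mk G (a.concat b) := rfl

instance : IsOrderedAddMonoid (W X G) where
  add_le_add_left := by
    rintro ⟨a⟩ ⟨b⟩ h ⟨c⟩
    exact K.concat_le h (K.le_refl c)

end Semigroup

/-! ### Regular invariant premeasures -/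

section Premeasure

/-- The algebra of sets generated by the open sets. -/
def openAlgebra (X : Type*) [TopologicalSpace X] : Set (Set X) :=
  MeasureTheory.generateSetAlgebra {U : Set X | IsOpen U}

/-- `Pr_G(X)`: regular `G`-invariant premeasures on the algebra generated by the open sets,
with values in `[0, ∞]`. Only the values on that algebra are meaningful. -/
structure RegularInvariantPremeasure (G X : Type*) [Group G] [TopologicalSpace X]
    [MulAction G X] where
  toFun : Set X → ℝ≥0∞
  empty' : toFun ∅ = 0
  iUnion' : ∀ A : ℕ → Set X, (∀ n, A n ∈ openAlgebra X) → (⋃ n, A n) ∈ openAlgebra X →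
    Pairwise (fun m n => Disjoint (A m) (A n)) → toFun (⋃ n, A n) = ∑' n, toFun (A n)
  smul' : ∀ (g : G), ∀ A ∈ openAlgebra X, toFun (g • A) = toFun A
  inner' : ∀ B ∈ openAlgebra X, toFun B = ⨆ (F : Set X) (_ : F ⊆ B) (_ : IsCompact F), toFun F
  outer' : ∀ B ∈ openAlgebra X, toFun B = ⨅ (O : Set X) (_ : B ⊆ O) (_ : IsOpen O), toFun O

instance (G X : Type*) [Group G] [TopologicalSpace X] [MulAction G X] :
    CoeFun (RegularInvariantPremeasure G X) fun _ => Set X → ℝ≥0∞ :=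
  ⟨RegularInvariantPremeasure.toFun⟩

end Premeasure

end TypeSemigroup

/-!
The relation `≺` does not increase premeasures: inner regularity reduces this to closed subsets of
the `Oᵢ`, which are cut into pieces and moved disjointly into the `Vᵣ` (`SubEquiv.sum_le`). So each
`μ` in `Pr_G(X)` is an additive monotone functional on `W(X, G)`, and `(n + 1)[a] ≤ n[b]` forces
`∑ μ(Aᵢ) ≤ n / (n + 1) < 1` whenever `∑ μ(Bⱼ) = 1`. The inclusion `⋃ Aᵢ ⊆ G · ⋃ Bⱼ` comes from the
same argument, for the premeasure that is `0` on subsets of `G · ⋃ Bⱼ` and `∞` on all other sets.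
This is one implication.

For the converse, `a ≼ b` need only be shown after replacing every `fᵢ` by `(fᵢ - ε)₊`, because a
closed subset of `supp fᵢ` lies in `supp (fᵢ - ε)₊` for small `ε`
(`le_of_forall_sub_const_le`). Let `a_ε` be the resulting tuple.
By almost unperforation it suffices that `(n + 1)[a_ε] ≤ n[b]` for some `n > 0`. Otherwise a
Hahn–Banach argument in the ordered monoid `W(X, G)` gives a state `φ`, possibly with value `∞`,
with `φ(b) = 1 ≤ φ(a_ε)` (`exists_ennreal_state_of_forall_not_le`). It is carried out without
passing to a group or a vector space: a minimal subadditive functional is additive, since otherwise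
`x ↦ inf_n (q(x + n y) - n q(y))` is smaller.

On the invariant open set `Y = G · ⋃ Bⱼ` the state is finite near compact sets, so
`F ↦ inf {φ(O) : F ⊆ O open}` is a content on the locally compact space `Y`. The associated regular
measure `ν` is invariant, `∑ ν(Bⱼ) ≤ φ(b) = 1`, and `∑ ν(Aᵢ) ≥ φ(a_ε) ≥ 1`, since a compact set lies
between `supp (fᵢ - ε)₊` and `supp fᵢ` (`exists_regular_measure`). As `G` is countable,
`∑ ν(Bⱼ) = 0` would give `ν(Y) = 0`; so `ν` can be normalised. Extending it by `∞` to the sets not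
contained in `Y` keeps both regularity properties (`RegularInvariantPremeasure.ofMeasure`) and
yields a premeasure with `∑ μ(Bⱼ) = 1 ≤ ∑ μ(Aᵢ)`, contrary to the assumption.
-/

namespace TypeSemigroup

/-! ### States on ordered commutative monoids -/

section States

variable {M : Type*} [AddCommMonoid M] [PartialOrder M]

/-- A subadditive substitute for a state `φ` of `M` with `φ b = 1` and `φ a ≥ 1`. Minimal elements
among these are additive. Superhomogeneity is needed for the infima defining smaller functionals
to be bounded below; the two constraints at `a` and `b` are stated as translation laws, since
these, unlike `q b = 1` and `1 ≤ q a`, survive the passage to a smaller functional. -/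
structure IsSubstate (a b : M) (q : M → ℝ) : Prop where
  mono : Monotone q
  map_zero : q 0 = 0
  add_le : ∀ x y, q (x + y) ≤ q x + q y
  le_nsmul : ∀ (n : ℕ) x, n * q x ≤ q (n • x)
  add_unit : ∀ x, q (x + b) = q x + 1
  le_add : ∀ x, q x + 1 ≤ q (x + a)

variable {a b : M} {q : M → ℝ}

theorem IsSubstate.nonneg (hq : IsSubstate a b q) (pos : ∀ x : M, 0 ≤ x) (x : M) : 0 ≤ q x :=
  hq.map_zero ▸ hq.mono (pos x)

/-- The infimum of a nonempty chain of substates is a substate. -/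
theorem IsSubstate.iInf_chain (pos : ∀ x : M, 0 ≤ x) {c : Set (M → ℝ)} (hne : c.Nonempty)
    (hc : IsChain (· ≤ ·) c) (h : ∀ q ∈ c, IsSubstate a b q) :
    IsSubstate a b fun x => ⨅ q : c, q.1 x := by
  have : Nonempty c := hne.to_subtype
  have bdd : ∀ x, BddBelow (Set.range fun q : c => q.1 x) := fun x =>
    ⟨0, by rintro _ ⟨q, rfl⟩; exact (h q q.2).nonneg pos x⟩
  refine ⟨fun x y hxy => ciInf_mono (bdd x) fun q => (h q q.2).mono hxy, ?_, fun x y => ?_,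
    fun n x => ?_, fun x => ?_, fun x => ?_⟩
  · exact (iInf_congr fun q : c => (h q q.2).map_zero).trans ciInf_const
  · rw [← sub_le_iff_le_add]
    refine le_ciInf fun q₁ => ?_
    rw [sub_le_comm]
    refine le_ciInf fun q₂ => ?_
    rw [sub_le_iff_le_add']
    obtain ⟨q, h₁, h₂⟩ : ∃ q : c, q.1 ≤ q₁.1 ∧ q.1 ≤ q₂.1 :=
      (hc.total q₁.2 q₂.2).elim (fun h => ⟨q₁, le_rfl, h⟩) fun h => ⟨q₂, h, le_rfl⟩
    exact (ciInf_le (bdd _) q).trans (((h q q.2).add_le x y).trans (add_le_add (h₁ x) (h₂ y)))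
  · refine le_ciInf fun q => le_trans ?_ ((h q q.2).le_nsmul n x)
    exact mul_le_mul_of_nonneg_left (ciInf_le (bdd x) q) n.cast_nonneg
  · refine le_antisymm ?_ (le_ciInf fun q => ?_)
    · rw [← sub_le_iff_le_add]
      refine le_ciInf fun q => ?_
      rw [sub_le_iff_le_add, ← (h q q.2).add_unit]
      exact ciInf_le (bdd _) q
    · exact (add_le_add_left (ciInf_le (bdd x) q) 1).trans ((h q q.2).add_unit x).ge
  · refine le_ciInf fun q => ?_
    exact (add_le_add_left (ciInf_le (bdd x) q) 1).trans ((h q q.2).le_add x)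

/-- The substate obtained from `q` by forcing additivity in the direction `y`. -/
theorem IsSubstate.directional [IsOrderedAddMonoid M] (pos : ∀ x : M, 0 ≤ x)
    (hq : IsSubstate a b q) (y : M) :
    IsSubstate a b (fun x => ⨅ n : ℕ, (q (x + n • y) - n * q y)) ∧
      ∀ (x : M) (n : ℕ), (⨅ n : ℕ, (q (x + n • y) - n * q y)) ≤ q (x + n • y) - n * q y := by
  have low : ∀ (x : M) (n : ℕ), 0 ≤ q (x + n • y) - n * q y := fun x n => by
    have h₁ := hq.le_nsmul n y
    have h₂ : q (n • y) ≤ q (x + n • y) := hq.mono (le_add_of_nonneg_left (pos x))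
    linarith
  have bdd : ∀ x, BddBelow (Set.range fun n : ℕ => q (x + n • y) - n * q y) := fun x =>
    ⟨0, by rintro _ ⟨n, rfl⟩; exact low x n⟩
  have anti : ∀ x, Antitone fun n : ℕ => q (x + n • y) - n * q y := fun x =>
    antitone_nat_of_succ_le fun n => by
      have := hq.add_le (x + n • y) y
      rw [succ_nsmul, ← add_assoc]
      push_cast
      linarith
  refine ⟨⟨fun x x' h => ?_, ?_, fun x x' => ?_, fun N x => ?_, fun x => ?_, fun x => ?_⟩,
    fun x n => ciInf_le (bdd x) n⟩
  · exact ciInf_mono (bdd x) fun n => sub_le_sub_right (hq.mono (by gcongr)) _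
  · refine le_antisymm ?_ (le_ciInf fun n => low 0 n)
    simpa [hq.map_zero] using ciInf_le (bdd 0) 0
  · rw [← sub_le_iff_le_add]
    refine le_ciInf fun n => ?_
    rw [sub_le_comm]
    refine le_ciInf fun m => ?_
    rw [sub_le_iff_le_add']
    refine (ciInf_le (bdd _) (n + m)).trans ?_
    have h := hq.add_le (x + n • y) (x' + m • y)
    have e : x + x' + (n + m) • y = x + n • y + (x' + m • y) := by rw [add_nsmul]; abel
    rw [e]
    push_cast
    linarith
  · refine le_ciInf fun n => ?_
    rcases N.eq_zero_or_pos with rfl | hN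
    · simpa using low 0 n
    -- By antitonicity, `n` may be replaced by `N * n`.
    refine le_trans ?_ (anti (N • x) (Nat.le_mul_of_pos_left n hN))
    have h₁ := hq.le_nsmul N (x + n • y)
    have h₂ := mul_le_mul_of_nonneg_left (ciInf_le (bdd x) n) (Nat.cast_nonneg (α := ℝ) N)
    rw [nsmul_add, ← mul_nsmul'] at h₁
    push_cast
    linarith
  · refine le_antisymm ?_ (le_ciInf fun n => ?_)
    · rw [← sub_le_iff_le_add]
      refine le_ciInf fun n => ?_
      have := ciInf_le (bdd (x + b)) n
      rw [add_right_comm, hq.add_unit] at this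
      linarith
    · have := ciInf_le (bdd x) n
      rw [add_right_comm, hq.add_unit]
      linarith
  · refine le_ciInf fun n => ?_
    have := ciInf_le (bdd x) n
    have h := hq.le_add (x + n • y)
    rw [add_right_comm] at h
    linarith

/-- A Hahn–Banach argument inside the monoid: a substate yields a state. -/
theorem IsSubstate.exists_additive [IsOrderedAddMonoid M] (pos : ∀ x : M, 0 ≤ x)
    (hq : IsSubstate a b q) :
    ∃ φ : M → ℝ, IsSubstate a b φ ∧ ∀ x y, φ (x + y) = φ x + φ y := by
  obtain ⟨φ, -, hφ, hmin⟩ := zorn_le_nonempty₀ (α := (M → ℝ)ᵒᵈ)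
    {q | IsSubstate a b (OrderDual.ofDual q)} (fun c hc hchain y hy => by
      let c' : Set (M → ℝ) := c
      have h : ∀ q ∈ c', IsSubstate a b q := fun q hq => hc hq
      refine ⟨OrderDual.toDual fun x => ⨅ q : c', q.1 x,
        IsSubstate.iInf_chain pos ⟨y, hy⟩ hchain.symm h, fun z hz x => ?_⟩
      refine ciInf_le (f := fun q : c' => q.1 x) ⟨0, ?_⟩ ⟨z, hz⟩
      rintro _ ⟨q, rfl⟩
      exact (h q q.2).nonneg pos x) q hq
  replace hφ : IsSubstate a b (M := M) φ := hφ
  refine ⟨φ, hφ, fun x y => le_antisymm (hφ.add_le x y) ?_⟩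
  obtain ⟨h₁, h₂⟩ := hφ.directional pos y
  have h₃ := hmin (y := OrderDual.toDual _) h₁ (fun z => (h₂ z 0).trans (by simp)) x
  have h₄ : φ x ≤ _ := h₃
  have h₅ := h₄.trans (h₂ x 1)
  rw [one_nsmul, Nat.cast_one, one_mul] at h₅
  linarith

/-- `FracBound a b x r` says that `n φ(x) + i φ(b) + j φ(a) ≤ (k + j) φ(b)` with `(k - i) / n ≤ r`
is forced by the order of `M`; as `φ(b) = 1 ≤ φ(a)`, this gives the upper bound `φ(x) ≤ r`
for the states `φ` under consideration. -/
def FracBound (a b x : M) (r : ℝ) : Prop :=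
  ∃ n i j k : ℕ, 0 < n ∧ n • x + i • b + j • a ≤ (k + j) • b ∧ (k : ℝ) - i ≤ n * r

variable [IsOrderedAddMonoid M]

/-- Cancellation in multiples: `c + u ≤ c + v` gives `c + N u ≤ c + N v`. -/
theorem add_nsmul_le_add_nsmul {c u v : M} (h : c + u ≤ c + v) (N : ℕ) :
    c + N • u ≤ c + N • v := by
  induction N with
  | zero => simp
  | succ N ih =>
    calc c + (N + 1) • u = (c + u) + N • u := by rw [succ_nsmul]; abel
      _ ≤ (c + v) + N • u := by gcongr
      _ = (c + N • u) + v := by abel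
      _ ≤ (c + N • v) + v := by gcongr
      _ = c + (N + 1) • v := by rw [succ_nsmul]; abel

theorem FracBound.nonneg (pos : ∀ x : M, 0 ≤ x) {m : ℕ} (ham : a ≤ m • b)
    (h : ∀ n : ℕ, 0 < n → ¬ (n + 1) • a ≤ n • b) {x : M} {r : ℝ} (hr : FracBound a b x r) :
    0 ≤ r := by
  obtain ⟨n, i, j, k, hn, hle, hr⟩ := hr
  by_contra! hneg
  have hki : k + 1 ≤ i := by
    have h₁ : (n : ℝ) * r < 0 := mul_neg_of_pos_of_neg (by exact_mod_cast hn) hneg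
    have h₂ : (k : ℝ) < i := by linarith
    exact_mod_cast h₂
  have h₁ : k • b + (b + j • a) ≤ k • b + j • b :=
    calc k • b + (b + j • a) = (k + 1) • b + j • a := by rw [succ_nsmul]; abel
      _ ≤ i • b + j • a := by gcongr; exact pos b
      _ ≤ n • x + (i • b + j • a) := le_add_of_nonneg_left (pos _)
      _ ≤ k • b + j • b := by rw [← add_assoc, ← add_nsmul]; exact hle
  -- After `m * (k + 1)` repetitions, the gain of `m * (k + 1)` copies of `b` beats `k • b`
  -- even when it is measured in copies of `a`.
  have h₂ := add_nsmul_le_add_nsmul h₁ (m * (k + 1))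
  have h₃ : (k + 1 + m * (k + 1) * j) • a ≤ (k + m * (k + 1) * j) • b :=
    calc (k + 1 + m * (k + 1) * j) • a
        = (k + 1) • a + (m * (k + 1) * j) • a := add_nsmul _ _ _
      _ ≤ (k + 1) • (m • b) + (m * (k + 1) * j) • a := by gcongr
      _ = (m * (k + 1)) • (b + j • a) := by
        rw [nsmul_add, ← mul_nsmul', ← mul_nsmul', mul_comm m (k + 1)]
      _ ≤ k • b + (m * (k + 1)) • (b + j • a) := le_add_of_nonneg_left (pos _)
      _ ≤ k • b + (m * (k + 1)) • (j • b) := h₂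
      _ = _ := by rw [← mul_nsmul', ← add_nsmul]
  rcases (k + m * (k + 1) * j).eq_zero_or_pos with h₀ | h₀
  · -- Here `a ≤ 0`, so that already `2 a ≤ b`.
    have h₄ : a ≤ 0 := by
      have e : k + 1 + m * (k + 1) * j = 1 := by omega
      simpa [e, h₀] using h₃
    refine h 1 one_pos ?_
    calc (1 + 1) • a ≤ (1 + 1) • (0 : M) := by gcongr
      _ = 0 := nsmul_zero _
      _ ≤ 1 • b := pos _
  · exact h _ h₀ (by rwa [show k + m * (k + 1) * j + 1 = k + 1 + m * (k + 1) * j by ring])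

theorem FracBound.add {x y : M} {r s : ℝ} (hx : FracBound a b x r) (hy : FracBound a b y s) :
    FracBound a b (x + y) (r + s) := by
  obtain ⟨n, i, j, k, hn, h, hr⟩ := hx
  obtain ⟨n', i', j', k', hn', h', hs⟩ := hy
  refine ⟨n' * n, n' * i + n * i', n' * j + n * j', n' * k + n * k', Nat.mul_pos hn' hn, ?_, ?_⟩
  · have h₁ := add_le_add (nsmul_le_nsmul_right h n') (nsmul_le_nsmul_right h' n)
    simp only [nsmul_add, ← mul_nsmul'] at h₁
    convert! h₁ using 1
    · simp only [add_nsmul, nsmul_add, mul_comm n' n]; abel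
    · rw [← add_nsmul]; congr 1; ring
  · have h₁ := mul_le_mul_of_nonneg_left hr (Nat.cast_nonneg (α := ℝ) n')
    have h₂ := mul_le_mul_of_nonneg_left hs (Nat.cast_nonneg (α := ℝ) n)
    push_cast
    linarith

/-- The infimum of the bounds forced by the order is a substate. -/
theorem isSubstate_sInf_fracBound (pos : ∀ x : M, 0 ≤ x) (hunit : ∀ x : M, ∃ m : ℕ, x ≤ m • b)
    (h : ∀ n : ℕ, 0 < n → ¬ (n + 1) • a ≤ n • b) :
    IsSubstate a b fun x => sInf {r | FracBound a b x r} := by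
  obtain ⟨m₀, hm₀⟩ := hunit a
  have nonneg : ∀ {x r}, FracBound a b x r → 0 ≤ r := FracBound.nonneg pos hm₀ h
  have bdd : ∀ x, BddBelow {r | FracBound a b x r} := fun x => ⟨0, fun r hr => nonneg hr⟩
  have ne : ∀ x, {r | FracBound a b x r}.Nonempty := fun x => by
    obtain ⟨m, hm⟩ := hunit x
    exact ⟨m, 1, 0, 0, m, one_pos, by simpa using hm, by simp⟩
  refine ⟨fun x y hxy => ?_, ?_, fun x y => ?_, fun N x => ?_, fun x => ?_, fun x => ?_⟩
  · refine csInf_le_csInf (bdd x) (ne y) fun r hr => ?_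
    obtain ⟨n, i, j, k, hn, hle, hr⟩ := hr
    exact ⟨n, i, j, k, hn, le_trans (by gcongr) hle, hr⟩
  · refine le_antisymm (csInf_le (bdd 0) ⟨1, 0, 0, 0, one_pos, by simp, by simp⟩)
      (le_csInf (ne 0) fun r hr => nonneg hr)
  · rw [← sub_le_iff_le_add]
    refine le_csInf (ne x) fun r hr => ?_
    rw [sub_le_comm]
    refine le_csInf (ne y) fun s hs => ?_
    rw [sub_le_iff_le_add']
    exact csInf_le (bdd _) (hr.add hs)
  · refine le_csInf (ne _) fun r hr => ?_
    rcases N.eq_zero_or_pos with rfl | hN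
    · simpa using nonneg hr
    have hN' : (0 : ℝ) < N := by exact_mod_cast hN
    rw [← le_div_iff₀' hN']
    refine csInf_le (bdd x) ?_
    obtain ⟨n, i, j, k, hn, hle, hr⟩ := hr
    refine ⟨n * N, i, j, k, Nat.mul_pos hn hN, by rwa [mul_nsmul'], hr.trans_eq ?_⟩
    push_cast
    field_simp
  · refine le_antisymm ?_ (le_csInf (ne _) fun r hr => ?_)
    · rw [← sub_le_iff_le_add]
      refine le_csInf (ne x) fun r hr => ?_
      rw [sub_le_iff_le_add]
      refine csInf_le (bdd _) ?_
      obtain ⟨n, i, j, k, hn, hle, hr⟩ := hr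
      refine ⟨n, i, j, k + n, hn, ?_, by push_cast; linarith⟩
      calc n • (x + b) + i • b + j • a = (n • x + i • b + j • a) + n • b := by
            rw [nsmul_add]; abel
        _ ≤ (k + j) • b + n • b := by gcongr
        _ = (k + n + j) • b := by rw [← add_nsmul]; congr 1; ring
    · rw [← le_sub_iff_add_le]
      refine csInf_le (bdd _) ?_
      obtain ⟨n, i, j, k, hn, hle, hr⟩ := hr
      refine ⟨n, i + n, j, k, hn, le_of_eq_of_le ?_ hle, by push_cast; linarith⟩
      rw [nsmul_add, add_nsmul]; abel
  · refine le_csInf (ne _) fun r hr => ?_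
    rw [← le_sub_iff_add_le]
    refine csInf_le (bdd _) ?_
    obtain ⟨n, i, j, k, hn, hle, hr⟩ := hr
    refine ⟨n, i + n, j + n, k, hn, ?_, by push_cast; linarith⟩
    calc n • x + (i + n) • b + (j + n) • a = (n • (x + a) + i • b + j • a) + n • b := by
          rw [nsmul_add, add_nsmul, add_nsmul]; abel
      _ ≤ (k + j) • b + n • b := by gcongr
      _ = (k + (j + n)) • b := by rw [← add_nsmul, add_assoc]

/-- If no inequality `(n + 1) a ≤ n b` with `n > 0` holds, then some state, normalised at the
order unit `b`, is at least `1` at `a`. -/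
theorem exists_state_of_forall_not_le (pos : ∀ x : M, 0 ≤ x)
    (hunit : ∀ x : M, ∃ m : ℕ, x ≤ m • b) (h : ∀ n : ℕ, 0 < n → ¬ (n + 1) • a ≤ n • b) :
    ∃ φ : M →+ ℝ≥0, Monotone φ ∧ φ b = 1 ∧ 1 ≤ φ a := by
  obtain ⟨φ, hφ, hadd⟩ := (isSubstate_sInf_fracBound pos hunit h).exists_additive pos
  have hnn := hφ.nonneg pos
  refine ⟨⟨⟨fun x => ⟨φ x, hnn x⟩, Subtype.ext hφ.map_zero⟩,
    fun x y => Subtype.ext (hadd x y)⟩, fun x y hxy => hφ.mono hxy, Subtype.ext ?_, ?_⟩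
  · have := hφ.add_unit 0
    rwa [hφ.map_zero, zero_add, zero_add] at this
  · have := hφ.le_add 0
    rw [hφ.map_zero, zero_add, zero_add] at this
    exact this

/-- The version of `exists_state_of_forall_not_le` without an order unit: the state is extended by
`∞` off the ideal generated by `b`. -/
theorem exists_ennreal_state_of_forall_not_le (pos : ∀ x : M, 0 ≤ x) {m : ℕ} (ham : a ≤ m • b)
    (h : ∀ n : ℕ, 0 < n → ¬ (n + 1) • a ≤ n • b) :
    ∃ φ : M →+ ℝ≥0∞, Monotone φ ∧ φ b = 1 ∧ 1 ≤ φ a := by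
  classical
  let I : AddSubmonoid M :=
    { carrier := {x | ∃ m : ℕ, x ≤ m • b}
      zero_mem' := ⟨0, by simp⟩
      add_mem' := by
        rintro x y ⟨m, hm⟩ ⟨m', hm'⟩
        exact ⟨m + m', by rw [add_nsmul]; exact add_le_add hm hm'⟩ }
  have hI : ∀ {x y : M}, x ≤ y → y ∈ I → x ∈ I := fun hxy ⟨m, hm⟩ => ⟨m, hxy.trans hm⟩
  have ha : a ∈ I := ⟨m, ham⟩
  have hb : b ∈ I := ⟨1, by simp⟩
  obtain ⟨φ, hmono, hφb, hφa⟩ := exists_state_of_forall_not_le (M := I) (a := ⟨a, ha⟩)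
    (b := ⟨b, hb⟩) (fun x => pos x.1) (fun ⟨x, m, hm⟩ => ⟨m, hm⟩) (fun n hn hle => h n hn hle)
  refine ⟨⟨⟨fun x => if hx : x ∈ I then (φ ⟨x, hx⟩ : ℝ≥0∞) else ∞, ?_⟩, fun x y => ?_⟩,
    fun x y hxy => ?_, ?_, ?_⟩
  · have : φ ⟨0, I.zero_mem⟩ = 0 := map_zero φ
    simp [this]
  · by_cases hx : x ∈ I
    · by_cases hy : y ∈ I
      · have : φ ⟨x + y, I.add_mem hx hy⟩ = φ ⟨x, hx⟩ + φ ⟨y, hy⟩ := map_add φ ⟨x, hx⟩ ⟨y, hy⟩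
        simp [hx, hy, I.add_mem hx hy, this]
      · have : x + y ∉ I := fun hxy => hy (hI (le_add_of_nonneg_left (pos x)) hxy)
        simp [hy, this]
    · have : x + y ∉ I := fun hxy => hx (hI (le_add_of_nonneg_right (pos y)) hxy)
      simp [hx, this]
  · by_cases hy : y ∈ I
    · have hx := hI hxy hy
      have := hmono (a := ⟨x, hx⟩) (b := ⟨y, hy⟩) hxy
      simpa [hx, hy] using this
    · simp [hy]
  · simp [hb, hφb]
  · simpa [ha] using hφa

end States

/-! ### Premeasures and the type semigroup -/

section Premeasures

open MeasureTheory Set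

theorem mem_openAlgebra_of_isOpen {X : Type*} [TopologicalSpace X] {U : Set X} (hU : IsOpen U) :
    U ∈ openAlgebra X :=
  self_subset_generateSetAlgebra hU

theorem isSetAlgebra_openAlgebra (X : Type*) [TopologicalSpace X] :
    IsSetAlgebra (openAlgebra X) :=
  isSetAlgebra_generateSetAlgebra

theorem measurableSet_of_mem_openAlgebra {X : Type*} [TopologicalSpace X] [MeasurableSpace X]
    [BorelSpace X] {A : Set X} (hA : A ∈ openAlgebra X) : MeasurableSet A := by
  induction hA with
  | base s hs => exact IsOpen.measurableSet hs
  | empty => exact MeasurableSet.empty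
  | compl s _ ih => exact ih.compl
  | union s t _ _ h₁ h₂ => exact h₁.union h₂

theorem mem_openAlgebra_of_isCompact {X : Type*} [TopologicalSpace X] [T2Space X] {F : Set X}
    (hF : IsCompact F) : F ∈ openAlgebra X := by
  rw [← compl_compl F]
  exact (isSetAlgebra_openAlgebra X).compl_mem (mem_openAlgebra_of_isOpen hF.isClosed.isOpen_compl)

variable {G X : Type*} [Group G] [TopologicalSpace X] [MulAction G X]

/-- A regular invariant Borel measure on an invariant open set `Y`, extended by `∞` to all sets
not contained in `Y`. -/
noncomputable def RegularInvariantPremeasure.ofMeasure [T2Space X] [MeasurableSpace X]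
    [BorelSpace X] {Y : Set X} (hY : IsOpen Y) (hGY : ∀ g : G, g • Y = Y) (ν : Measure Y)
    [ν.OuterRegular] [ν.InnerRegular]
    (hν : ∀ (g : G) (A : Set X), MeasurableSet A → A ⊆ Y →
      ν (Subtype.val ⁻¹' (g • A)) = ν (Subtype.val ⁻¹' A)) :
    RegularInvariantPremeasure G X := by
  classical
  refine
    { toFun := fun A => if A ⊆ Y then ν (Subtype.val ⁻¹' A) else ∞
      empty' := by simp
      iUnion' := fun A hA _ hdisj => ?_
      smul' := fun g A hA => ?_
      inner' := fun B hB => ?_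
      outer' := fun B hB => ?_ }
  · by_cases h : ∀ n, A n ⊆ Y
    · rw [if_pos (iUnion_subset h), preimage_iUnion, measure_iUnion]
      · exact tsum_congr fun n => (if_pos (h n)).symm
      · exact fun m n hmn => (hdisj hmn).preimage _
      · exact fun n => measurable_subtype_coe (measurableSet_of_mem_openAlgebra (hA n))
    · obtain ⟨n, hn⟩ := not_forall.1 h
      rw [if_neg fun hU => h (iUnion_subset_iff.1 hU)]
      exact (ENNReal.tsum_eq_top_of_eq_top ⟨n, if_neg hn⟩).symm
  · have hiff : g • A ⊆ Y ↔ A ⊆ Y := by rw [← hGY g, smul_set_subset_smul_set_iff, hGY g]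
    by_cases h : A ⊆ Y
    · rw [if_pos (hiff.2 h), if_pos h, hν g A (measurableSet_of_mem_openAlgebra hA) h]
    · rw [if_neg (mt hiff.1 h), if_neg h]
  · refine le_antisymm ?_ (iSup_le fun F => iSup_le fun hF => iSup_le fun _ => ?_)
    · by_cases h : B ⊆ Y
      · rw [if_pos h]
        have hm : MeasurableSet ((↑) ⁻¹' B : Set Y) :=
          measurable_subtype_coe (measurableSet_of_mem_openAlgebra hB)
        rw [hm.measure_eq_iSup_isCompact]
        refine iSup_le fun C => iSup_le fun hC => iSup_le fun hCc => ?_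
        have hsub : Subtype.val '' C ⊆ B := image_subset_iff.2 hC
        refine le_iSup_of_le (Subtype.val '' C) (le_iSup_of_le hsub
          (le_iSup_of_le (hCc.image continuous_subtype_val) ?_))
        rw [if_pos (hsub.trans h), preimage_image_eq _ Subtype.val_injective]
      · obtain ⟨x, hxB, hxY⟩ := not_subset.1 h
        refine le_iSup_of_le {x} (le_iSup_of_le (singleton_subset_iff.2 hxB)
          (le_iSup_of_le isCompact_singleton ?_))
        rw [if_neg (show ¬ {x} ⊆ Y by simpa using hxY)]
        exact le_top
    · by_cases h : B ⊆ Y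
      · rw [if_pos h, if_pos (hF.trans h)]
        exact measure_mono (preimage_mono hF)
      · rw [if_neg h]
        exact le_top
  · refine le_antisymm (le_iInf fun O => le_iInf fun hO => le_iInf fun _ => ?_) ?_
    · by_cases h : O ⊆ Y
      · rw [if_pos h, if_pos (hO.trans h)]
        exact measure_mono (preimage_mono hO)
      · rw [if_neg h]
        exact le_top
    · by_cases h : B ⊆ Y
      · rw [if_pos h, Set.measure_eq_iInf_isOpen]
        refine le_iInf fun C => le_iInf fun hC => le_iInf fun hCo => ?_
        have hBC : B ⊆ Subtype.val '' C := fun x hx => ⟨⟨x, h hx⟩, hC hx, rfl⟩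
        refine iInf_le_of_le (Subtype.val '' C) (iInf_le_of_le hBC
          (iInf_le_of_le (hY.isOpenMap_subtype_val C hCo) ?_))
        rw [if_pos (by simp), preimage_image_eq _ Subtype.val_injective]
      · rw [if_neg h]
        exact le_top

open Classical in
theorem RegularInvariantPremeasure.ofMeasure_apply [T2Space X] [MeasurableSpace X]
    [BorelSpace X] {Y : Set X} (hY : IsOpen Y) (hGY : ∀ g : G, g • Y = Y) (ν : Measure Y)
    [ν.OuterRegular] [ν.InnerRegular]
    (hν : ∀ (g : G) (A : Set X), MeasurableSet A → A ⊆ Y →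
      ν (Subtype.val ⁻¹' (g • A)) = ν (Subtype.val ⁻¹' A)) (A : Set X) :
    ofMeasure hY hGY ν hν A = if A ⊆ Y then ν (Subtype.val ⁻¹' A) else ∞ :=
  rfl

variable (μ : RegularInvariantPremeasure G X)

theorem RegularInvariantPremeasure.union_of_disjoint {A B : Set X} (hA : A ∈ openAlgebra X)
    (hB : B ∈ openAlgebra X) (h : Disjoint A B) : μ (A ∪ B) = μ A + μ B := by
  have halg := isSetAlgebra_openAlgebra X
  let C : ℕ → Set X := fun n => if n = 0 then A else if n = 1 then B else ∅
  have hU : ⋃ n, C n = A ∪ B := by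
    refine subset_antisymm (iUnion_subset fun n => ?_) (union_subset ?_ ?_)
    · rcases n with _ | _ | n
      · exact subset_union_left
      · exact subset_union_right
      · exact empty_subset _
    · exact subset_iUnion C 0
    · exact subset_iUnion C 1
  have hC := μ.iUnion' C (fun n => ?_) (hU ▸ halg.union_mem hA hB) ?_
  · rw [hU, tsum_eq_sum (s := {0, 1})] at hC
    · simpa [C] using hC
    · rintro (_ | _ | n) hn
      · simp at hn
      · simp at hn
      · exact μ.empty'
  · rcases n with _ | _ | n
    exacts [hA, hB, halg.empty_mem]
  · rintro (_ | _ | m) (_ | _ | n) hmn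
    all_goals first | exact (hmn rfl).elim | skip
    exacts [h, disjoint_empty _, h.symm, disjoint_empty _, empty_disjoint _, empty_disjoint _,
      empty_disjoint _]

theorem RegularInvariantPremeasure.mono {A B : Set X} (hA : A ∈ openAlgebra X)
    (hB : B ∈ openAlgebra X) (h : A ⊆ B) : μ A ≤ μ B := by
  rw [← union_sdiff_cancel h, μ.union_of_disjoint hA
    ((isSetAlgebra_openAlgebra X).sdiff_mem hB hA) disjoint_sdiff_right]
  exact le_self_add

theorem RegularInvariantPremeasure.union_le {A B : Set X} (hA : A ∈ openAlgebra X)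
    (hB : B ∈ openAlgebra X) : μ (A ∪ B) ≤ μ A + μ B := by
  have hBA := (isSetAlgebra_openAlgebra X).sdiff_mem hB hA
  rw [← union_sdiff_self, μ.union_of_disjoint hA hBA disjoint_sdiff_right]
  gcongr
  exact μ.mono hBA hB sdiff_subset

theorem RegularInvariantPremeasure.biUnion_le {ι : Type*} (s : Finset ι) {A : ι → Set X}
    (hA : ∀ i, A i ∈ openAlgebra X) : μ (⋃ i ∈ s, A i) ≤ ∑ i ∈ s, μ (A i) := by
  classical
  induction s using Finset.induction_on with
  | empty => simpa using μ.empty'.le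
  | insert i s hi ih =>
    rw [Finset.set_biUnion_insert, Finset.sum_insert hi]
    refine (μ.union_le (hA i) ((isSetAlgebra_openAlgebra X).biUnion_mem s fun i _ => hA i)).trans ?_
    gcongr

theorem RegularInvariantPremeasure.biUnion_of_disjoint {ι : Type*} (s : Finset ι)
    {A : ι → Set X} (hA : ∀ i, A i ∈ openAlgebra X)
    (hd : (s : Set ι).PairwiseDisjoint A) : μ (⋃ i ∈ s, A i) = ∑ i ∈ s, μ (A i) := by
  classical
  induction s using Finset.induction_on with
  | empty => simpa using μ.empty'
  | insert i s hi ih =>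
    rw [Finset.set_biUnion_insert, Finset.sum_insert hi, μ.union_of_disjoint (hA i)
      ((isSetAlgebra_openAlgebra X).biUnion_mem s fun i _ => hA i), ih]
    · exact hd.subset (by simp)
    · refine disjoint_iUnion₂_right.2 fun j hj => hd (by simp) (by simp [hj]) ?_
      rintro rfl
      exact hi hj

/-- Regular invariant premeasures are monotone under the relation `≺`: by inner regularity it
suffices to compare the measures of closed subsets of the `O i`, and those are cut into pieces
which are moved disjointly into the `V r`. -/
theorem SubEquiv.sum_le [T2Space X] [ContinuousConstSMul G X] {ι κ : Type*} [Fintype ι]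
    [Fintype κ] {O : ι → Set X} {V : κ → Set X} (hO : ∀ i, IsOpen (O i)) (hV : ∀ r, IsOpen (V r))
    (h : SubEquiv G O V) : ∑ i, μ (O i) ≤ ∑ r, μ (V r) := by
  classical
  have key : ∀ F : ι → Set X, (∀ i, IsCompact (F i) ∧ F i ⊆ O i) →
      ∑ i, μ (F i) ≤ ∑ r, μ (V r) := by
    intro F hF
    obtain ⟨J, U, s, c, hU, hFU, hUV, hdisj⟩ := h F fun i => ⟨(hF i).1.isClosed, (hF i).2⟩
    have hsU : ∀ p : (Σ i, Fin (J i)), s p.1 p.2 • U p.1 p.2 ∈ openAlgebra X := fun p =>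
      mem_openAlgebra_of_isOpen ((hU _ _).smul _)
    calc ∑ i, μ (F i) ≤ ∑ i, ∑ j, μ (U i j) := by
          refine Finset.sum_le_sum fun i _ => ?_
          have hu : (⋃ j, U i j) = ⋃ j ∈ (Finset.univ : Finset (Fin (J i))), U i j := by simp
          refine (μ.mono (mem_openAlgebra_of_isCompact (hF i).1)
            (mem_openAlgebra_of_isOpen (isOpen_iUnion (hU i))) (hFU i)).trans ?_
          rw [hu]
          exact μ.biUnion_le _ fun j => mem_openAlgebra_of_isOpen (hU i j)
      _ = ∑ p : (Σ i, Fin (J i)), μ (s p.1 p.2 • U p.1 p.2) := by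
          rw [Fintype.sum_sigma]
          exact Finset.sum_congr rfl fun i _ => Finset.sum_congr rfl fun j _ =>
            (μ.smul' _ _ (mem_openAlgebra_of_isOpen (hU i j))).symm
      _ = ∑ r, ∑ p : (Σ i, Fin (J i)) with c p.1 p.2 = r, μ (s p.1 p.2 • U p.1 p.2) :=
          (Finset.sum_fiberwise _ _ _).symm
      _ ≤ ∑ r, μ (V r) := by
          refine Finset.sum_le_sum fun r _ => ?_
          rw [← μ.biUnion_of_disjoint _ hsU]
          · refine μ.mono ((isSetAlgebra_openAlgebra X).biUnion_mem _ fun p _ => hsU p)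
              (mem_openAlgebra_of_isOpen (hV r)) (iUnion₂_subset fun p hp => ?_)
            obtain rfl : c p.1 p.2 = r := by simpa using hp
            exact hUV p.1 p.2
          · intro p hp q hq hpq
            have hp' : c p.1 p.2 = r := by simpa using hp
            have hq' : c q.1 q.2 = r := by simpa using hq
            exact hdisj hpq (hp'.trans hq'.symm)
  let T := {F : ι → Set X // ∀ i, IsCompact (F i) ∧ F i ⊆ O i}
  have sup : ∀ i, μ (O i) ≤ ⨆ F : T, μ (F.1 i) := fun i => by
    rw [μ.inner' _ (mem_openAlgebra_of_isOpen (hO i))]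
    refine iSup_le fun C => iSup_le fun hCO => iSup_le fun hC => ?_
    let F : ι → Set X := Function.update (fun _ => ∅) i C
    have hF : ∀ j, IsCompact (F j) ∧ F j ⊆ O j := fun j => by
      rcases eq_or_ne j i with rfl | hj
      · simpa [F] using ⟨hC, hCO⟩
      · simp [F, hj]
    exact le_iSup_of_le ⟨F, hF⟩ (by simp [F])
  have closed : ∀ (F : T) i, F.1 i ∈ openAlgebra X := fun F i =>
    mem_openAlgebra_of_isCompact (F.2 i).1
  refine (Finset.sum_le_sum fun i _ => sup i).trans ?_
  rw [ENNReal.finsetSum_iSup]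
  · exact iSup_le fun F => key F.1 F.2
  · intro F F'
    let E : T := ⟨fun i => F.1 i ∪ F'.1 i, fun i =>
      ⟨(F.2 i).1.union (F'.2 i).1, union_subset (F.2 i).2 (F'.2 i).2⟩⟩
    exact ⟨E, fun i => ⟨μ.mono (closed F i) (closed E i) subset_union_left,
      μ.mono (closed F' i) (closed E i) subset_union_right⟩⟩

variable [CompactSpace X] [T2Space X] [ContinuousConstSMul G X]

theorem W.zero_le (x : W X G) : 0 ≤ x := by
  obtain ⟨a⟩ := x
  have h : ∀ i, ¬ ((K.zero : K X).supp i).Nonempty := fun i ⟨x, hx⟩ => hx rfl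
  exact K.le_of_map (a := K.zero) (b := a) (fun i => (h i.1 i.2).elim)
    (fun i => (h i.1 i.2).elim) fun i => (h i.1 i.2).elim

/-- The functional `[(f₁, …, fₙ)] ↦ ∑ᵢ μ(supp fᵢ)` on the type semigroup. -/
noncomputable def RegularInvariantPremeasure.onW : W X G →+ ℝ≥0∞ where
  toFun := Quotient.lift (fun a : K X => ∑ i, μ (a.supp i)) fun _ _ h =>
    le_antisymm (SubEquiv.sum_le μ (fun _ => isOpen_supp _) (fun _ => isOpen_supp _) h.1)
      (SubEquiv.sum_le μ (fun _ => isOpen_supp _) (fun _ => isOpen_supp _) h.2)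
  map_zero' := by
    refine Finset.sum_eq_zero fun i _ => ?_
    have : (K.zero : K X).supp i = ∅ := eq_empty_of_forall_notMem fun x hx => hx rfl
    rw [this]
    exact μ.empty'
  map_add' := by
    rintro ⟨a⟩ ⟨b⟩
    refine (Fin.sum_univ_add (fun i : Fin (a.len + b.len) => μ ((a.concat b).supp i))).trans ?_
    congr 1
    · exact Finset.sum_congr rfl fun i _ =>
        congrArg (fun f => μ (TypeSemigroup.supp f)) (K.concat_fn_left a b i)
    · exact Finset.sum_congr rfl fun i _ =>
        congrArg (fun f => μ (TypeSemigroup.supp f)) (K.concat_fn_right a b i)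

theorem RegularInvariantPremeasure.onW_mk (a : K X) :
    μ.onW (W.mk G a) = ∑ i, μ (a.supp i) :=
  rfl

theorem RegularInvariantPremeasure.onW_mono : Monotone μ.onW := by
  rintro ⟨a⟩ ⟨b⟩ h
  exact SubEquiv.sum_le μ (fun _ => isOpen_supp _) (fun _ => isOpen_supp _) h

end Premeasures

/-! ### Classes of open sets -/

section OpenClass

open TopologicalSpace Set

variable {G X : Type*} [Group G] [TopologicalSpace X] [MulAction G X]

theorem exists_supp_eq [MetrizableSpace X] (O : Opens X) : ∃ f : C(X, ℝ≥0), supp f = O := by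
  let := metrizableSpaceMetric X
  rcases (O : Set X)ᶜ.eq_empty_or_nonempty with h | h
  · exact ⟨1, by rw [compl_empty_iff.1 h]; ext; simp [supp]⟩
  · refine ⟨⟨fun x => Metric.infNndist x (O : Set X)ᶜ, Metric.continuous_infNndist_pt _⟩, ?_⟩
    ext x
    have : Metric.infNndist x (O : Set X)ᶜ = 0 ↔ x ∈ (O : Set X)ᶜ := by
      rw [O.isOpen.isClosed_compl.mem_iff_infDist_zero h, ← Metric.coe_infNndist,
        NNReal.coe_eq_zero]
    simpa [supp] using not_congr this

theorem SubEquiv.of_subset_iUnion {κ : Type} [Finite κ] {O : Fin 1 → Set X} {V : κ → Set X}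
    (hV : ∀ r, IsOpen (V r)) (h : O 0 ⊆ ⋃ r, V r) : SubEquiv G O V := by
  refine SubEquiv.of_finite fun F hF => ⟨fun _ => κ, fun _ => inferInstance, fun _ r => V r,
    fun _ _ => 1, fun _ r => r, fun _ r => hV r, fun i => ?_, fun _ r => (one_smul G _).subset, ?_⟩
  · rw [Subsingleton.elim i 0]
    exact (hF 0).2.trans h
  · rintro ⟨i, r⟩ ⟨i', r'⟩ hne rfl
    exact (hne (by rw [Subsingleton.elim i i'])).elim

/-- Disjoint open sets can be moved simultaneously into a single one. -/
theorem SubEquiv.of_pairwise_disjoint {ι : Type*} {O : ι → Set X} {V : Fin 1 → Set X}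
    (hO : ∀ i, IsOpen (O i)) (g : G) (hd : Pairwise fun i j => Disjoint (O i) (O j))
    (h : ∀ i, g • O i ⊆ V 0) : SubEquiv G O V := by
  refine SubEquiv.of_finite fun F hF => ⟨fun _ => PUnit, fun _ => inferInstance, fun i _ => O i,
    fun _ _ => g, fun _ _ => 0, fun i _ => hO i, fun i => ?_, fun i _ => h i, ?_⟩
  · exact (hF i).2.trans (subset_iUnion (fun _ : PUnit => O i) ⟨⟩)
  · rintro ⟨i, _⟩ ⟨j, _⟩ hne -
    refine (hd (i := i) (j := j) ?_).image (MulAction.injective g).injOn (subset_univ _)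
      (subset_univ _)
    rintro rfl
    exact hne rfl

variable [CompactSpace X] [ContinuousConstSMul G X]

section T2

variable [T2Space X]

theorem W.mk_eq_sum (n : ℕ) (hn : 0 < n) (f : Fin n → C(X, ℝ≥0)) :
    W.mk G ⟨n, hn, f⟩ = ∑ i, W.mk G ⟨1, one_pos, fun _ => f i⟩ := by
  induction n, hn using Nat.le_induction with
  | base =>
    rw [Fin.sum_univ_one]
    congr 2
    ext i
    rw [Subsingleton.elim i 0]
  | succ n hn ih =>
    rw [Fin.sum_univ_castSucc, ← ih fun i => f i.castSucc, W.mk_add_mk]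
    congr 1
    have : f = Fin.append (fun i : Fin n => f i.castSucc) (fun _ : Fin 1 => f (Fin.last n)) := by
      rw [Fin.append_right_eq_snoc]
      exact (Fin.snoc_init_self f).symm
    exact congrArg (K.mk (n + 1) n.succ_pos) this

end T2

variable [MetrizableSpace X]

variable (G) in
/-- The class in `W(X, G)` of the one-entry tuple given by any function with open support `O`. -/
noncomputable def openClass (O : Opens X) : W X G :=
  W.mk G ⟨1, one_pos, fun _ => (exists_supp_eq O).choose⟩

theorem mk_singleton (f : C(X, ℝ≥0)) :
    W.mk G ⟨1, one_pos, fun _ => f⟩ = openClass G ⟨supp f, isOpen_supp f⟩ := by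
  have h := (exists_supp_eq ⟨supp f, isOpen_supp f⟩).choose_spec
  refine le_antisymm ?_ ?_
  · refine W.mk_le_mk.2 (SubEquiv.of_subset_iUnion (fun _ => isOpen_supp _) ?_)
    exact fun x hx => mem_iUnion.2 ⟨0, h.symm.subset hx⟩
  · refine W.mk_le_mk.2 (SubEquiv.of_subset_iUnion (fun _ => isOpen_supp _) ?_)
    exact fun x hx => mem_iUnion.2 ⟨0, h.subset hx⟩

theorem mk_eq_sum_openClass (n : ℕ) (hn : 0 < n) (f : Fin n → C(X, ℝ≥0)) :
    W.mk G ⟨n, hn, f⟩ = ∑ i, openClass G ⟨supp (f i), isOpen_supp (f i)⟩ := by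
  rw [W.mk_eq_sum]
  exact Finset.sum_congr rfl fun i _ => mk_singleton (f i)

theorem openClass_add (O O' : Opens X) :
    ∃ f : Fin 2 → C(X, ℝ≥0), supp (f 0) = O ∧ supp (f 1) = O' ∧
      openClass G O + openClass G O' = W.mk G ⟨2, two_pos, f⟩ := by
  obtain ⟨f, hf⟩ := exists_supp_eq O
  obtain ⟨f', hf'⟩ := exists_supp_eq O'
  refine ⟨![f, f'], hf, hf', ?_⟩
  rw [mk_eq_sum_openClass, Fin.sum_univ_two]
  congr 2
  · exact Opens.ext hf.symm
  · exact Opens.ext hf'.symm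

theorem openClass_mono : Monotone (openClass G : Opens X → W X G) := fun O O' h =>
  W.mk_le_mk.2 <| SubEquiv.of_subset_iUnion (fun _ => isOpen_supp _) fun _ hx =>
    mem_iUnion.2 ⟨0, (exists_supp_eq O').choose_spec.symm.subset
      (h ((exists_supp_eq O).choose_spec.subset hx))⟩

theorem openClass_sup_le (O O' : Opens X) :
    openClass G (O ⊔ O') ≤ openClass G O + openClass G O' := by
  obtain ⟨f, h₀, h₁, hf⟩ := openClass_add (G := G) O O'
  rw [hf]
  refine W.mk_le_mk.2 (SubEquiv.of_subset_iUnion (fun _ => isOpen_supp _) fun x hx => ?_)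
  rcases (exists_supp_eq (O ⊔ O')).choose_spec.subset hx with h | h
  · exact mem_iUnion.2 ⟨(0 : Fin 2), h₀.symm.subset h⟩
  · exact mem_iUnion.2 ⟨(1 : Fin 2), h₁.symm.subset h⟩

theorem openClass_add_le {O O' V : Opens X} (h : Disjoint (O : Set X) O') (hO : O ≤ V)
    (hO' : O' ≤ V) : openClass G O + openClass G O' ≤ openClass G V := by
  obtain ⟨f, h₀, h₁, hf⟩ := openClass_add (G := G) O O'
  rw [hf]
  have hV := (exists_supp_eq V).choose_spec
  refine W.mk_le_mk.2 (SubEquiv.of_pairwise_disjoint (fun _ => isOpen_supp _) 1 ?_ ?_)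
  · rw [← h₀, ← h₁] at h
    intro (i : Fin 2) (j : Fin 2) hij
    change Disjoint (supp (f i)) (supp (f j))
    fin_cases i <;> fin_cases j
    exacts [(hij rfl).elim, h, h.symm, (hij rfl).elim]
  · intro (i : Fin 2)
    rw [one_smul]
    change supp (f i) ⊆ supp _
    rw [hV]
    fin_cases i
    · exact h₀.subset.trans hO
    · exact h₁.subset.trans hO'

theorem openClass_le_of_smul_subset {O V : Opens X} (g : G) (h : g • (O : Set X) ⊆ V) :
    openClass G O ≤ openClass G V := by
  refine W.mk_le_mk.2 (SubEquiv.of_pairwise_disjoint (fun _ => isOpen_supp _) g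
    (fun i j hij => (hij (Subsingleton.elim (α := Fin 1) i j)).elim) fun i => ?_)
  change g • supp _ ⊆ supp _
  rwa [(exists_supp_eq V).choose_spec, (exists_supp_eq O).choose_spec]

/-- A compact set covered by translates of open sets whose classes are at most `b` has an open
neighbourhood whose class is at most a multiple of `b`. -/
theorem exists_openClass_le_nsmul {ι : Type*} {B : ι → Opens X} {b : W X G}
    (hB : ∀ j, openClass G (B j) ≤ b) {F : Set X} (hF : IsCompact F)
    (hFB : F ⊆ ⋃ s : G, s • ⋃ j, (B j : Set X)) :
    ∃ O : Opens X, F ⊆ O ∧ ∃ m : ℕ, openClass G O ≤ m • b := by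
  refine hF.induction_on (p := fun S => ∃ O : Opens X, S ⊆ O ∧ ∃ m : ℕ, openClass G O ≤ m • b)
    ?_ ?_ ?_ ?_
  · refine ⟨⊥, empty_subset _, 0, ?_⟩
    rw [zero_nsmul]
    refine W.mk_le_mk.2 (SubEquiv.of_subset_iUnion (fun _ => isOpen_supp _) fun x hx => ?_)
    exact ((exists_supp_eq (⊥ : Opens X)).choose_spec.subset hx).elim
  · exact fun s t hst ⟨O, hO, h⟩ => ⟨O, hst.trans hO, h⟩
  · rintro s t ⟨O, hO, m, hm⟩ ⟨O', hO', m', hm'⟩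
    refine ⟨O ⊔ O', union_subset_union hO hO', m + m', ?_⟩
    rw [add_nsmul]
    exact (openClass_sup_le O O').trans (add_le_add hm hm')
  · intro x hx
    obtain ⟨s, hs⟩ := mem_iUnion.1 (hFB hx)
    rw [smul_set_iUnion] at hs
    obtain ⟨j, hj⟩ := mem_iUnion.1 hs
    refine ⟨s • (B j : Set X), mem_nhdsWithin_of_mem_nhds
      (((B j).isOpen.smul s).mem_nhds hj), ⟨_, (B j).isOpen.smul s⟩, subset_rfl, 1, ?_⟩
    rw [one_nsmul]
    refine le_trans (openClass_le_of_smul_subset (V := B j) s⁻¹ ?_) (hB j)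
    exact (inv_smul_smul s (B j : Set X)).subset

end OpenClass

/-! ### From functionals on the type semigroup to measures -/

section Content

open TopologicalSpace Set MeasureTheory

variable {G X : Type*} [Group G] [TopologicalSpace X] [MulAction G X]
  [CompactSpace X] [ContinuousConstSMul G X] [MetrizableSpace X]

/-- The outer approximation of a set by the values of a functional on the classes of its open
neighbourhoods. -/
noncomputable def outerValue (φ : W X G →+ ℝ≥0∞) (S : Set X) : ℝ≥0∞ :=
  ⨅ O : {O : Opens X // S ⊆ O}, φ (openClass G O.1)

variable {φ : W X G →+ ℝ≥0∞}

theorem outerValue_le {S : Set X} (O : Opens X) (h : S ⊆ O) :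
    outerValue φ S ≤ φ (openClass G O) :=
  iInf_le (fun O : {O : Opens X // S ⊆ O} => φ (openClass G O.1)) ⟨O, h⟩

theorem outerValue_mono : Monotone (outerValue φ) := fun _ _ h =>
  le_iInf fun O => outerValue_le O.1 (h.trans O.2)

theorem outerValue_union_le (hφ : Monotone φ) (S T : Set X) :
    outerValue φ (S ∪ T) ≤ outerValue φ S + outerValue φ T := by
  refine ENNReal.le_iInf_add_iInf fun O O' => ?_
  refine (outerValue_le (O.1 ⊔ O'.1) (union_subset_union O.2 O'.2)).trans ?_
  rw [← map_add]
  exact hφ (openClass_sup_le O.1 O'.1)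

theorem outerValue_add_le (hφ : Monotone φ) {S T : Set X} (hS : IsCompact S) (hT : IsCompact T)
    (h : Disjoint S T) : outerValue φ S + outerValue φ T ≤ outerValue φ (S ∪ T) := by
  obtain ⟨U, V, hU, hV, hSU, hTV, hUV⟩ := SeparatedNhds.of_isCompact_isCompact hS hT h
  refine le_iInf fun O => ?_
  have hd : Disjoint ((⟨U, hU⟩ ⊓ O.1 : Opens X) : Set X) (⟨V, hV⟩ ⊓ O.1 : Opens X) :=
    hUV.mono inter_subset_left inter_subset_left
  calc outerValue φ S + outerValue φ T
      ≤ φ (openClass G (⟨U, hU⟩ ⊓ O.1)) + φ (openClass G (⟨V, hV⟩ ⊓ O.1)) :=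
        add_le_add
          (outerValue_le _ (subset_inter hSU (subset_union_left.trans O.2)))
          (outerValue_le _ (subset_inter hTV (subset_union_right.trans O.2)))
    _ = φ (openClass G (⟨U, hU⟩ ⊓ O.1) + openClass G (⟨V, hV⟩ ⊓ O.1)) := (map_add φ _ _).symm
    _ ≤ φ (openClass G O.1) := hφ (openClass_add_le hd inf_le_right inf_le_right)

theorem outerValue_smul (hφ : Monotone φ) (g : G) (S : Set X) :
    outerValue φ (g • S) = outerValue φ S := by
  have key : ∀ (g : G) (S : Set X), outerValue φ (g • S) ≤ outerValue φ S := fun g S =>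
    le_iInf fun O => by
      refine (outerValue_le ⟨g • (O.1 : Set X), O.1.isOpen.smul g⟩ (smul_set_mono O.2)).trans
        (hφ (openClass_le_of_smul_subset g⁻¹ ?_))
      exact (inv_smul_smul g (O.1 : Set X)).subset
  refine le_antisymm (key g S) ?_
  simpa using key g⁻¹ (g • S)

/-- A monotone functional on `W(X, G)` which is locally finite on an invariant open set `Y` induces
a regular invariant Borel measure on `Y`. Its values on open sets are at most those of the
functional, and its values on compact sets dominate those of the functional on open subsets. -/
theorem exists_regular_measure (hφ : Monotone φ) [MeasurableSpace X] [BorelSpace X] {Y : Set X}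
    (hY : IsOpen Y) (hGY : ∀ g : G, g • Y = Y)
    (hfin : ∀ F : Set X, IsCompact F → F ⊆ Y →
      ∃ O : Opens X, F ⊆ O ∧ φ (openClass G O) ≠ ∞) :
    ∃ ν : Measure Y, ν.Regular ∧
      (∀ (g : G) (A : Set X), MeasurableSet A → A ⊆ Y →
        ν (Subtype.val ⁻¹' (g • A)) = ν (Subtype.val ⁻¹' A)) ∧
      (∀ O : Opens X, ν (Subtype.val ⁻¹' (O : Set X)) ≤ φ (openClass G O)) ∧
      ∀ (O : Opens X) (F : Set X), IsCompact F → F ⊆ Y → (O : Set X) ⊆ F →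
        φ (openClass G O) ≤ ν (Subtype.val ⁻¹' F) := by
  have : LocallyCompactSpace Y := hY.isOpenEmbedding_subtypeVal.locallyCompactSpace
  have hcpt : ∀ K : Compacts Y, IsCompact (Subtype.val '' (K : Set Y)) := fun K =>
    K.isCompact.image continuous_subtype_val
  have hne : ∀ K : Compacts Y, outerValue φ (Subtype.val '' (K : Set Y)) ≠ ∞ := fun K => by
    obtain ⟨O, hKO, hO⟩ := hfin _ (hcpt K) (by simp)
    exact ne_top_of_le_ne_top hO (outerValue_le O hKO)
  let c : Content Y :=
    { toFun := fun K => (outerValue φ (Subtype.val '' (K : Set Y))).toNNReal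
      mono' := fun K K' h => ENNReal.toNNReal_mono (hne K') (outerValue_mono (image_mono h))
      sup_disjoint' := fun K K' h _ _ => by
        rw [← ENNReal.toNNReal_add (hne K) (hne K'), Compacts.coe_sup, image_union]
        congr 1
        exact le_antisymm (outerValue_union_le hφ _ _) (outerValue_add_le hφ (hcpt K) (hcpt K')
          (h.image Subtype.val_injective.injOn (subset_univ _) (subset_univ _)))
      sup_le' := fun K K' => by
        rw [← ENNReal.toNNReal_add (hne K) (hne K'), Compacts.coe_sup, image_union]
        exact ENNReal.toNNReal_mono (ENNReal.add_ne_top.2 ⟨hne K, hne K'⟩)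
          (outerValue_union_le hφ _ _) }
  have hc : ∀ K : Compacts Y, c K = outerValue φ (Subtype.val '' (K : Set Y)) := fun K =>
    ENNReal.coe_toNNReal (hne K)
  refine ⟨c.measure, inferInstance, fun g A hA hAY => ?_, fun O => ?_, fun O F hF hFY hOF => ?_⟩
  · have hmem : ∀ x, x ∈ Y ↔ g • x ∈ Y := fun x => by
      conv_rhs => rw [← hGY g]
      exact smul_mem_smul_set_iff.symm
    let e : Y ≃ₜ Y := (Homeomorph.smul g).subtype hmem
    have he : e ⁻¹' (Subtype.val ⁻¹' (g • A)) = Subtype.val ⁻¹' A := by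
      ext x
      exact smul_mem_smul_set_iff
    rw [c.measure_apply (measurable_subtype_coe (hA.const_smul g)),
      c.measure_apply (measurable_subtype_coe hA), ← he]
    refine (c.outerMeasure_preimage e (fun K => ?_) _).symm
    rw [hc, hc, ← outerValue_smul hφ g (Subtype.val '' (K : Set Y))]
    congr 1
    ext x
    constructor
    · rintro ⟨_, ⟨y, hy, rfl⟩, rfl⟩
      exact ⟨y, ⟨y, hy, rfl⟩, rfl⟩
    · rintro ⟨_, ⟨y, hy, rfl⟩, rfl⟩
      exact ⟨e y, ⟨y, hy, rfl⟩, rfl⟩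
  · have hO : IsOpen (Subtype.val ⁻¹' (O : Set X) : Set Y) :=
      O.isOpen.preimage continuous_subtype_val
    rw [c.measure_apply hO.measurableSet, c.outerMeasure_of_isOpen _ hO]
    refine iSup₂_le fun K hK => ?_
    rw [hc]
    exact outerValue_le O (image_subset_iff.2 hK)
  · have hF' : IsCompact (Subtype.val ⁻¹' F : Set Y) :=
      Topology.IsInducing.subtypeVal.isCompact_preimage' hF (by simpa using hFY)
    rw [c.measure_apply hF'.measurableSet]
    refine le_trans ?_ (c.le_outerMeasure_compacts ⟨_, hF'⟩)
    rw [hc]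
    refine le_iInf fun V => hφ (openClass_mono (hOF.trans ?_))
    refine subset_trans ?_ V.2
    exact fun x hx => ⟨⟨x, hFY hx⟩, hx, rfl⟩

end Content

/-! ### Almost unperforation and comparison -/

section Comparison

open TopologicalSpace Set MeasureTheory

theorem smul_iUnion_smul {G X : Type*} [Group G] [MulAction G X] (B : Set X) (g : G) :
    g • ⋃ s : G, s • B = ⋃ s : G, s • B := by
  rw [smul_set_iUnion]
  simp_rw [smul_smul]
  exact (Equiv.mulLeft g).surjective.iUnion_comp fun s => s • B

/-- Subtraction in `ℝ≥0` is truncated, so `f - ε` is the cut-down `(f - ε)₊`. -/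
theorem supp_sub_const {X : Type*} [TopologicalSpace X] (f : C(X, ℝ≥0)) (ε : ℝ≥0) :
    supp (f - ContinuousMap.const X ε) = {x | ε < f x} := by
  ext x
  simp [supp, tsub_eq_zero_iff_le]

/-- To prove `a ≼ b` it is enough to treat the cut-downs of `a`. -/
theorem le_of_forall_sub_const_le {G X : Type*} [Group G] [TopologicalSpace X]
    [MulAction G X] [CompactSpace X] {k : ℕ} {hk : 0 < k} {f : Fin k → C(X, ℝ≥0)} {b : K X}
    (h : ∀ ε : ℝ≥0, 0 < ε →
      K.Le G ⟨k, hk, fun i => f i - ContinuousMap.const X ε⟩ b) :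
    K.Le G ⟨k, hk, f⟩ b := by
  intro F hF
  have hδ : ∀ i, ∃ δ : ℝ≥0, 0 < δ ∧ ∀ x ∈ F i, δ ≤ f i x := fun i => by
    rcases (F i).eq_empty_or_nonempty with hi | hi
    · exact ⟨1, one_pos, by simp [hi]⟩
    · obtain ⟨x, hx, hmin⟩ := (hF i).1.isCompact.exists_isMinOn hi (f i).continuous.continuousOn
      exact ⟨f i x, pos_iff_ne_zero.2 ((hF i).2 hx), fun y hy => hmin hy⟩
  choose δ hδ hle using hδ
  obtain ⟨ε, hε, hεδ⟩ : ∃ ε : ℝ≥0, 0 < ε ∧ ∀ i, ε < δ i := by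
    have : Nonempty (Fin k) := ⟨⟨0, hk⟩⟩
    obtain ⟨i, hi⟩ := Finite.exists_min δ
    exact ⟨δ i / 2, half_pos (hδ i), fun j => (NNReal.half_lt_self (hδ i).ne').trans_le (hi j)⟩
  refine h ε hε F fun i => ⟨(hF i).1, ?_⟩
  change F i ⊆ supp _
  rw [supp_sub_const]
  exact fun x hx => (hεδ i).trans_le (hle i x hx)

variable {G X : Type*} [Group G] [TopologicalSpace X] [MulAction G X] [ContinuousConstSMul G X]

theorem isOpen_iUnion_smul_supp {l : ℕ} (g : Fin l → C(X, ℝ≥0)) :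
    IsOpen (⋃ s : G, s • ⋃ j, supp (g j)) :=
  isOpen_iUnion fun s => (isOpen_iUnion fun j => isOpen_supp (g j)).smul s

variable [CompactSpace X] [MetrizableSpace X] {k l : ℕ} {hk : 0 < k} {hl : 0 < l}

theorem iUnion_supp_subset_of_le {f : Fin k → C(X, ℝ≥0)} {g : Fin l → C(X, ℝ≥0)} {n : ℕ}
    (h : (n + 1) • W.mk G ⟨k, hk, f⟩ ≤ n • W.mk G ⟨l, hl, g⟩) :
    (⋃ i, supp (f i)) ⊆ ⋃ s : G, s • ⋃ j, supp (g j) := by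
  classical
  let _ : MeasurableSpace X := borel X
  have : BorelSpace X := ⟨rfl⟩
  -- The premeasure that vanishes on the subsets of `G • ⋃ j, supp (g j)` and is `∞` elsewhere
  -- detects the inclusion.
  let μ : RegularInvariantPremeasure G X := .ofMeasure
    (isOpen_iUnion_smul_supp (G := G) g) (smul_iUnion_smul _) 0 (fun _ _ _ _ => rfl)
  have hμ : ∀ A, μ A = if A ⊆ ⋃ s : G, s • ⋃ j, supp (g j) then 0 else ∞ :=
    RegularInvariantPremeasure.ofMeasure_apply _ _ _ _
  have h₁ := μ.onW_mono h
  have h₂ : μ.onW (W.mk G ⟨l, hl, g⟩) = 0 := by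
    rw [μ.onW_mk]
    refine Finset.sum_eq_zero fun j _ => (hμ _).trans (if_pos ?_)
    refine (subset_iUnion (fun j => supp (g j)) j).trans ?_
    simpa using subset_iUnion (fun s : G => s • ⋃ j, supp (g j)) 1
  rw [map_nsmul, map_nsmul, h₂, nsmul_zero, succ_nsmul, nonpos_iff_eq_zero, add_eq_zero,
    μ.onW_mk] at h₁
  refine iUnion_subset fun i => ?_
  have h₃ : μ (supp (f i)) = 0 := (Finset.sum_eq_zero_iff.1 h₁.2) i (Finset.mem_univ _)
  by_contra hi
  rw [hμ, if_neg hi] at h₃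
  exact ENNReal.top_ne_zero h₃

theorem sum_lt_sum_of_le {f : Fin k → C(X, ℝ≥0)} {g : Fin l → C(X, ℝ≥0)} {n : ℕ}
    (h : (n + 1) • W.mk G ⟨k, hk, f⟩ ≤ n • W.mk G ⟨l, hl, g⟩)
    (μ : RegularInvariantPremeasure G X) (hμ : ∑ j, μ (supp (g j)) = 1) :
    ∑ i, μ (supp (f i)) < ∑ j, μ (supp (g j)) := by
  have h₁ := μ.onW_mono h
  rw [map_nsmul, map_nsmul, μ.onW_mk, μ.onW_mk] at h₁
  change (n + 1) • ∑ i, μ (supp (f i)) ≤ n • ∑ j, μ (supp (g j)) at h₁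
  rw [hμ] at h₁ ⊢
  by_contra! hle
  have h₂ := (nsmul_le_nsmul_right hle (n + 1)).trans h₁
  rw [nsmul_one, nsmul_one] at h₂
  exact absurd (Nat.cast_le.1 h₂) (by omega)

/-- If `a` is cut down by `ε`, then strict comparison by premeasures gives the unperforated
inequality `(n + 1) a ≤ n b`: a state violating it would induce a premeasure contradicting the
comparison. -/
theorem exists_succ_nsmul_le_nsmul [Countable G] {f : Fin k → C(X, ℝ≥0)} {g : Fin l → C(X, ℝ≥0)}
    (hsub : (⋃ i, supp (f i)) ⊆ ⋃ s : G, s • ⋃ j, supp (g j))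
    (hμ : ∀ μ : RegularInvariantPremeasure G X, ∑ j, μ (supp (g j)) = 1 →
      ∑ i, μ (supp (f i)) < ∑ j, μ (supp (g j))) {ε : ℝ≥0} (hε : 0 < ε) :
    ∃ n : ℕ, 0 < n ∧
      (n + 1) • W.mk G ⟨k, hk, fun i => f i - ContinuousMap.const X ε⟩ ≤
        n • W.mk G ⟨l, hl, g⟩ := by
  classical
  by_contra! hcon
  let _ : MeasurableSpace X := borel X
  have : BorelSpace X := ⟨rfl⟩
  set Y : Set X := ⋃ s : G, s • ⋃ j, supp (g j) with hYdef
  have hY : IsOpen Y := isOpen_iUnion_smul_supp g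
  have hGY : ∀ s : G, s • Y = Y := smul_iUnion_smul _
  have hgY : ∀ j, supp (g j) ⊆ Y := fun j => (subset_iUnion (fun j => supp (g j)) j).trans <| by
    simpa using subset_iUnion (fun s : G => s • ⋃ j, supp (g j)) 1
  set a := W.mk G ⟨k, hk, fun i => f i - ContinuousMap.const X ε⟩ with ha
  set b := W.mk G ⟨l, hl, g⟩ with hb
  have ha' := mk_eq_sum_openClass (G := G) k hk fun i => f i - ContinuousMap.const X ε
  have hb' := mk_eq_sum_openClass (G := G) l hl g
  have hB : ∀ j, openClass G ⟨supp (g j), isOpen_supp (g j)⟩ ≤ b := fun j => by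
    rw [hb, hb']
    exact Finset.single_le_sum
      (f := fun j => openClass G ⟨supp (g j), isOpen_supp (g j)⟩)
      (fun j _ => W.zero_le _) (Finset.mem_univ j)
  have hcov : ∀ F : Set X, IsCompact F → F ⊆ Y →
      ∃ O : Opens X, F ⊆ O ∧ ∃ m : ℕ, openClass G O ≤ m • b := fun F hF hFY =>
    exists_openClass_le_nsmul hB hF hFY
  -- The compact set `{x | ε ≤ f i x}` separates `supp (f i - ε)` from `(supp (f i))ᶜ`.
  have hC : ∀ i, IsCompact {x | ε ≤ f i x} := fun i =>
    (isClosed_le continuous_const (f i).continuous).isCompact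
  have hCf : ∀ i, {x | ε ≤ f i x} ⊆ supp (f i) := fun i x hx => (hε.trans_le hx).ne'
  have hCY : ∀ i, {x | ε ≤ f i x} ⊆ Y := fun i =>
    (hCf i).trans ((subset_iUnion (fun i => supp (f i)) i).trans hsub)
  have hfC : ∀ i, supp (f i - ContinuousMap.const X ε) ⊆ {x | ε ≤ f i x} := fun i => by
    rw [supp_sub_const]
    exact fun x (hx : ε < f i x) => hx.le
  obtain ⟨m, hm⟩ : ∃ m : ℕ, a ≤ m • b := by
    choose O hO m hm using fun i => hcov _ (hC i) (hCY i)
    refine ⟨∑ i, m i, ?_⟩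
    rw [ha, ha', ← Finset.sum_nsmul_assoc]
    exact Finset.sum_le_sum fun i _ => (openClass_mono ((hfC i).trans (hO i))).trans (hm i)
  obtain ⟨φ, hφ, hφb, hφa⟩ := exists_ennreal_state_of_forall_not_le W.zero_le hm
    fun n hn hle => hcon n hn hle
  obtain ⟨ν, hreg, hinv, hopen, hcpt⟩ := exists_regular_measure hφ hY hGY fun F hF hFY => by
    obtain ⟨O, hFO, m, hOm⟩ := hcov F hF hFY
    refine ⟨O, hFO, ne_top_of_le_ne_top ?_ (hφ hOm)⟩
    rw [map_nsmul, hφb, nsmul_one]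
    exact ENNReal.natCast_ne_top m
  have hνg : ∑ j, ν (Subtype.val ⁻¹' supp (g j)) ≤ 1 := by
    rw [← hφb, hb, hb', map_sum]
    exact Finset.sum_le_sum fun j _ => hopen ⟨supp (g j), isOpen_supp (g j)⟩
  have hνf : 1 ≤ ∑ i, ν (Subtype.val ⁻¹' supp (f i)) := by
    refine hφa.trans ?_
    rw [ha, ha', map_sum]
    exact Finset.sum_le_sum fun i _ => (hcpt ⟨_, isOpen_supp _⟩ _ (hC i) (hCY i) (hfC i)).trans
      (measure_mono (preimage_mono (hCf i)))
  set t := ∑ j, ν (Subtype.val ⁻¹' supp (g j)) with ht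
  -- As `G` is countable, `Y` is null as soon as all `supp (g j)` are.
  have ht₀ : t ≠ 0 := by
    intro h₀
    have h₁ : ∀ (s : G) j, ν (Subtype.val ⁻¹' (s • supp (g j))) = 0 := fun s j => by
      rw [hinv s _ (isOpen_supp _).measurableSet (hgY j)]
      exact (Finset.sum_eq_zero_iff.1 h₀) j (Finset.mem_univ j)
    have h₂ : ν univ = 0 := by
      have h₃ : (univ : Set Y) ⊆ ⋃ s : G, ⋃ j, Subtype.val ⁻¹' (s • supp (g j)) := by
        rintro ⟨x, hx⟩ -
        simpa [hYdef, smul_set_iUnion] using hx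
      exact measure_mono_null h₃ (measure_iUnion_null fun s => measure_iUnion_null (h₁ s))
    have h₄ : ∑ i, ν (Subtype.val ⁻¹' supp (f i)) = 0 :=
      Finset.sum_eq_zero fun i _ => measure_mono_null (subset_univ _) h₂
    rw [h₄] at hνf
    exact absurd hνf (by simp)
  have ht₁ : t ≠ ∞ := ne_top_of_le_ne_top ENNReal.one_ne_top hνg
  have : LocallyCompactSpace Y := hY.isOpenEmbedding_subtypeVal.locallyCompactSpace
  have : (t⁻¹ • ν).OuterRegular := .smul ν (ENNReal.inv_ne_top.2 ht₀)
  let μ : RegularInvariantPremeasure G X := .ofMeasure hY hGY (t⁻¹ • ν)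
    fun s A hA hAY => by simp only [Measure.smul_apply, hinv s A hA hAY]
  have hμA : ∀ A, A ⊆ Y → μ A = t⁻¹ * ν (Subtype.val ⁻¹' A) := fun A hA =>
    (RegularInvariantPremeasure.ofMeasure_apply ..).trans (if_pos hA)
  have hμg : ∑ j, μ (supp (g j)) = 1 := by
    rw [Finset.sum_congr rfl fun j _ => hμA _ (hgY j), ← Finset.mul_sum]
    exact ENNReal.inv_mul_cancel ht₀ ht₁
  have hlt := hμ μ hμg
  rw [hμg, Finset.sum_congr rfl fun i _ => hμA _
    ((subset_iUnion (fun i => supp (f i)) i).trans hsub), ← Finset.mul_sum] at hlt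
  refine absurd hlt (not_lt.2 ?_)
  calc 1 ≤ t⁻¹ * 1 := by simpa using hνg
    _ ≤ _ := by gcongr

end Comparison

end TypeSemigroup

theorem theorem3p9 {G X : Type*} [Group G] [Countable G]
    [TopologicalSpace X] [CompactSpace X] [TopologicalSpace.MetrizableSpace X]
    [MulAction G X] [ContinuousConstSMul G X] (k l : ℕ) (hk : 0 < k) (hl : 0 < l) :
    (∀ (f : Fin k → C(X, ℝ≥0)) (g : Fin l → C(X, ℝ≥0)),
        (∃ n : ℕ, 0 < n ∧
          (n + 1) • TypeSemigroup.W.mk G ⟨k, hk, f⟩ ≤ n • TypeSemigroup.W.mk G ⟨l, hl, g⟩) →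
        TypeSemigroup.W.mk G ⟨k, hk, f⟩ ≤ TypeSemigroup.W.mk G ⟨l, hl, g⟩) ↔
    (∀ (f : Fin k → C(X, ℝ≥0)) (g : Fin l → C(X, ℝ≥0)),
        (⋃ i, TypeSemigroup.supp (f i)) ⊆ (⋃ s : G, s • ⋃ j, TypeSemigroup.supp (g j)) →
        (∀ μ : TypeSemigroup.RegularInvariantPremeasure G X,
          ∑ j, μ (TypeSemigroup.supp (g j)) = 1 →
          ∑ i, μ (TypeSemigroup.supp (f i)) < ∑ j, μ (TypeSemigroup.supp (g j))) →
        TypeSemigroup.K.Le G ⟨k, hk, f⟩ ⟨l, hl, g⟩) := by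
  open TypeSemigroup in
  constructor
  · intro h f g hsub hμ
    exact le_of_forall_sub_const_le fun ε hε =>
      W.mk_le_mk.1 (h _ g (exists_succ_nsmul_le_nsmul hsub hμ hε))
  · rintro h f g ⟨n, -, hn⟩
    exact W.mk_le_mk.2 (h f g (iUnion_supp_subset_of_le hn) (sum_lt_sum_of_le hn))
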